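/- Let $n\ge 1$, let $d\gamma(x)=\pi^{-n/2}e^{-|x|^2}\,dx$ be the Gauss measure on $\mathbb R^n$, and let $m(x)=\min\{1,1/|x|\}$ (with $m(0)=1$). For $a\in(0,\infty)$ let $\mathcal B_a$ be the set of all open balls $B=B(c_B,r_B)\subset\mathbb R^n$ with $0<r_B\le a\,m(c_B)$, and let $\mathcal B_a(x)$ be the set of those $B\in\mathcal B_a$ that contain $x$. All functions are real-valued, or all are complex-valued. A function $b\in L^1(\gamma)$ belongs to $\mathrm{BMO}(\gamma)$ if $$\|b\|_*=\sup_{B\in\mathcal B_1}\frac1{\gamma(B)}\int_B|b-b_B|\,d\gamma<\infty,\qquad b_B=\frac1{\gamma(B)}\int_B b\,d\gamma,$$ and then $\|b\|_{\mathrm{BMO}(\gamma)}=\|b\|_*+\|b\|_{L^1(\gamma)}$. Let $L_c^\infty(\gamma)$ be the set of all $f\in L^\infty(\gamma)$ with compact support. For $\beta\in(0,1)$, $b\in L^1(\gamma)$, $f\in L_c^\infty(\gamma)$ and $x\in\mathbb R^n$ set $$\widetilde{[b,\mathcal M_a^\beta]}(f)(x)=\sup_{B\in\mathcal B_a(x)}\frac1{[\gamma(B)]^{1-\beta}}\int_B|b(x)-b(y)||f(y)|\,d\gamma(y).$$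 **Theorem 1.2.** Let $a\in(0,\infty)$, $\beta\in(0,1)$, $1<p<q<\infty$ and $1/q=1/p-\beta$. Then there exists a positive constant $C$, depending only on $n$, $a$, $p$ and $q$, such that the following hold. (i) If $b\in\mathrm{BMO}(\gamma)$, then for all $f\in L_c^\infty(\gamma)$ the function $\widetilde{[b,\mathcal M_a^\beta]}(f)$ belongs to $L^q(\gamma)$ and $$\big\|\widetilde{[b,\mathcal M_a^\beta]}(f)\big\|_{L^q(\gamma)}\le C\|b\|_*\|f\|_{L^p(\gamma)}.$$ Moreover, $\widetilde{[b,\mathcal M_a^\beta]}$ extends from $L_c^\infty(\gamma)$ to a continuous sublinear operator $T$ from $L^p(\gamma)$ to $L^q(\gamma)$ with $\|Tf\|_{L^q(\gamma)}\le C\|b\|_*\|f\|_{L^p(\gamma)}$ for all $f\in L^p(\gamma)$, where sublinear means that $T(f+g)\le Tf+Tg$ almost everywhere and $T(\lambda f)=|\lambda|Tf$ for all scalars $\lambda$. The operator $T$ is the only extension of $\widetilde{[b,\mathcal M_a^\beta]}$ to a map from $L^p(\gamma)$ to $L^q(\gamma)$ that is continuous, and also the only one that is sublinear and bounded. (ii)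 If $b\in L^1(\gamma)$ and $\widetilde{[b,\mathcal M_a^\beta]}$ is bounded from $L^p(\gamma)\cap L_c^\infty(\gamma)$ to $L^q(\gamma)$, that is, it maps $L_c^\infty(\gamma)$ into $L^q(\gamma)$ and there is a constant $K<\infty$ with $\|\widetilde{[b,\mathcal M_a^\beta]}(f)\|_{L^q(\gamma)}\le K\|f\|_{L^p(\gamma)}$ for all $f\in L_c^\infty(\gamma)$, then $b\in\mathrm{BMO}(\gamma)$ and $$\|b\|_{\mathrm{BMO}(\gamma)}\le\|b\|_{L^1(\gamma)}+C\,\big\|\widetilde{[b,\mathcal M_a^\beta]}\big\|_{L^p(\gamma)\to L^q(\gamma)},$$ where the operator norm is the least such $K$. -/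

import Mathlib

open MeasureTheory
open scoped ENNReal NNReal

noncomputable section

namespace GaussBMO

/-- The Gauss measure `dγ(x) = π^(-n/2) exp(-|x|²) dx` on `ℝⁿ`. -/
def gauss (n : ℕ) : Measure (EuclideanSpace ℝ (Fin n)) :=
  volume.withDensity
    (fun x => ENNReal.ofReal (Real.pi ^ (-(n : ℝ) / 2) * Real.exp (-‖x‖ ^ 2)))

/-- The function `m(x) = min {1, 1/|x|}`, with `m(0) = 1`, written as `1 / max {1, |x|}`. -/
def m {n : ℕ} (x : EuclideanSpace ℝ (Fin n)) : ℝ := (max 1 ‖x‖)⁻¹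

/-- The open ball with centre `c` and radius `r > 0` belongs to the admissible class `𝓑_a`:
`r ≤ a m(c)`. -/
def Admissible {n : ℕ} (a : ℝ) (c : EuclideanSpace ℝ (Fin n)) (r : ℝ) : Prop :=
  0 < r ∧ r ≤ a * m c

variable {n : ℕ} {𝕜 : Type*} [RCLike 𝕜]

/-- The mean oscillation `γ(B)⁻¹ ∫_B |b - b_B| dγ` on the ball `B = B(c, r)`. -/
def meanOsc (b : EuclideanSpace ℝ (Fin n) → 𝕜) (c : EuclideanSpace ℝ (Fin n)) (r : ℝ) : ℝ≥0∞ :=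
  (gauss n (Metric.ball c r))⁻¹ *
    ∫⁻ x in Metric.ball c r, ‖b x - ⨍ y in Metric.ball c r, b y ∂(gauss n)‖ₑ ∂(gauss n)

/-- `‖b‖_*`: the supremum of the mean oscillations over all balls of `𝓑_1`. -/
def starNorm (b : EuclideanSpace ℝ (Fin n) → 𝕜) : ℝ≥0∞ :=
  ⨆ (c : EuclideanSpace ℝ (Fin n)) (r : ℝ) (_ : Admissible 1 c r), meanOsc b c r

/-- `b ∈ BMO(γ)`. -/
def MemBMO (b : EuclideanSpace ℝ (Fin n) → 𝕜) : Prop :=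
  Integrable b (gauss n) ∧ starNorm b < ∞

/-- `‖b‖_{BMO(γ)} = ‖b‖_* + ‖b‖_{L¹(γ)}`. -/
def bmoNorm (b : EuclideanSpace ℝ (Fin n) → 𝕜) : ℝ≥0∞ :=
  starNorm b + eLpNorm b 1 (gauss n)

/-- The commutator `[b, M_a^β]~ (f)(x)`, with values in `[0, ∞]`: the supremum, over all balls
`B ∈ 𝓑_a` containing `x`, of `γ(B)^(β-1) ∫_B |b(x) - b(y)| |f(y)| dγ(y)`. -/
def maxComm (a β : ℝ) (b f : EuclideanSpace ℝ (Fin n) → 𝕜) (x : EuclideanSpace ℝ (Fin n)) :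
    ℝ≥0∞ :=
  ⨆ (c : EuclideanSpace ℝ (Fin n)) (r : ℝ) (_ : Admissible a c r) (_ : x ∈ Metric.ball c r),
    (gauss n (Metric.ball c r) ^ (1 - β))⁻¹ *
      ∫⁻ y in Metric.ball c r, ‖b x - b y‖ₑ * ‖f y‖ₑ ∂(gauss n)

/-- `f ∈ L_c^∞(γ)`: essentially bounded with compact support. -/
def MemLcInfty (f : EuclideanSpace ℝ (Fin n) → 𝕜) : Prop :=
  MemLp f ∞ (gauss n) ∧ HasCompactSupport f

/-- `[b, M_a^β]~` maps `L_c^∞(γ) = L^p(γ) ∩ L_c^∞(γ)` into `L^q(γ)`, and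
`‖[b, M_a^β]~(f)‖_{L^q(γ)} ≤ K ‖f‖_{L^p(γ)}` for all `f ∈ L_c^∞(γ)`. -/
def CommBound (a β : ℝ) (p q : ℝ≥0∞) (b : EuclideanSpace ℝ (Fin n) → 𝕜) (K : ℝ≥0∞) : Prop :=
  ∀ f : EuclideanSpace ℝ (Fin n) → 𝕜, MemLcInfty f →
    MemLp (maxComm a β b f) q (gauss n) ∧
      eLpNorm (maxComm a β b f) q (gauss n) ≤ K * eLpNorm f p (gauss n)

/-- The operator norm of `[b, M_a^β]~` from `L^p(γ) ∩ L_c^∞(γ)` to `L^q(γ)`: the infimum of the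
admissible constants (`∞` if the operator is not bounded). -/
def commNorm (a β : ℝ) (p q : ℝ≥0∞) (b : EuclideanSpace ℝ (Fin n) → 𝕜) : ℝ≥0∞ :=
  ⨅ (K : ℝ≥0) (_ : CommBound a β p q b K), (K : ℝ≥0∞)

/-- The map `S : L^p(γ) → L^q(γ)` extends `[b, M_a^β]~` from `L_c^∞(γ)`. -/
def ExtendsComm (a β : ℝ) (p q : ℝ≥0∞) (b : EuclideanSpace ℝ (Fin n) → 𝕜)
    (S : Lp 𝕜 p (gauss n) → Lp ℝ q (gauss n)) : Prop :=
  ∀ f : EuclideanSpace ℝ (Fin n) → 𝕜, MemLcInfty f →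
    ∀ F : Lp 𝕜 p (gauss n), F =ᵐ[gauss n] f →
      S F =ᵐ[gauss n] fun x => (maxComm a β b f x).toReal

/-- `S : L^p(γ) → L^q(γ)` is sublinear: `S(F + G) ≤ S F + S G` almost everywhere and
`S(z F) = |z| S F`. (In particular `S F ≥ 0`.) -/
def IsSublinear {p q : ℝ≥0∞} (S : Lp 𝕜 p (gauss n) → Lp ℝ q (gauss n)) : Prop :=
  (∀ F G, S (F + G) ≤ S F + S G) ∧ ∀ (z : 𝕜) F, S (z • F) = ‖z‖ • S F

/-- `‖S F‖_{L^q(γ)} ≤ K ‖F‖_{L^p(γ)}` for all `F ∈ L^p(γ)`. -/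
def OpBound {p q : ℝ≥0∞} (S : Lp 𝕜 p (gauss n) → Lp ℝ q (gauss n)) (K : ℝ≥0∞) : Prop :=
  ∀ F, eLpNorm (S F) q (gauss n) ≤ K * eLpNorm F p (gauss n)

/-- Continuity of `S : L^p(γ) → L^q(γ)` with respect to the norms. -/
def NormContinuous {p q : ℝ≥0∞} (S : Lp 𝕜 p (gauss n) → Lp ℝ q (gauss n)) : Prop :=
  ∀ F, ∀ ε > 0, ∃ δ > 0, ∀ G, ‖G - F‖ < δ → ‖S G - S F‖ < ε

end GaussBMO

end

open MeasureTheory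
open scoped ENNReal NNReal

noncomputable section

namespace GaussBMO

open Metric Set Filter Topology

/-! The Gauss measure `γ` is not globally doubling, but its density varies only by a bounded factor
on a ball of `𝓑_A`, since `||x|² - |c|²| ≤ 2A + A²` there. So `γ` is doubling on admissible balls
(`gauss_ball_le`), and the Vitali covering argument, the maximal theorem (`maxFun_strong`) and the
John–Nirenberg inequality (`john_nirenberg`) hold locally. A chaining argument shows that the scale
used to define BMO is immaterial (`meanOsc_le_of_admissible`).

Sufficiency: by Hölder, the commutator average over `B` is at most a fractional average of `f` times
the oscillation of `b` around any constant (`commAv_le`). Sort the balls by the dyadic size `2^k` of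
the fractional average, and thin each class to disjoint balls `P` whose dilates `5P` absorb every
`B` of the class. With the mean of `b` over `5P` as the constant, the oscillation factor depends on
`P` alone, and its `q`-th power integrates over `5P` to `O(γ(P))`. There remains a sum of `2^(kq)
γ(⋃ P)`, bounded by a level sum of a function that dominates the fractional averages. Hedberg's
inequality (`fracAv_rpow_le`) and the maximal theorem control the `L^q` norm of that function.
Sublinearity makes the extension Lipschitz, and density of `L_c^∞` makes it unique.

Necessity: testing on the indicator of `B` bounds the mean oscillation over `B`, because the powers
of `γ(B)` cancel when `1/q = 1/p - β` (`meanOsc_le_of_commBound`). The change of scale then leads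
from `𝓑_a` to `𝓑_1`. -/

/-- Euclidean space `ℝⁿ`. -/
abbrev E (n : ℕ) := EuclideanSpace ℝ (Fin n)

variable {n : ℕ} {𝕜 : Type*} [RCLike 𝕜]

/-! ### Admissible balls and local doubling -/

theorem m_pos (x : E n) : 0 < m x := by
  unfold m; positivity

theorem m_le_one (x : E n) : m x ≤ 1 := inv_le_one_of_one_le₀ (le_max_left _ _)

theorem norm_mul_m_le_one (x : E n) : ‖x‖ * m x ≤ 1 := by
  unfold m
  rw [← div_eq_mul_inv, div_le_one (by positivity)]
  exact le_max_right _ _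

theorem m_le_of_dist_le {A : ℝ} (hA : 0 ≤ A) {x c : E n} (h : dist x c ≤ A * m c) :
    m c ≤ (1 + A) * m x := by
  have h1 : ‖x‖ ≤ ‖c‖ + A := by
    have : ‖x‖ ≤ ‖c‖ + dist x c := by
      rw [dist_eq_norm]; simpa using norm_add_le c (x - c)
    nlinarith [m_le_one c]
  have h2 : max 1 ‖x‖ ≤ (1 + A) * max 1 ‖c‖ := by
    refine max_le ?_ ?_
    · nlinarith [le_max_left 1 ‖c‖]
    · nlinarith [le_max_left 1 ‖c‖, le_max_right 1 ‖c‖]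
  unfold m
  rw [← div_eq_mul_inv, inv_eq_one_div, div_le_div_iff₀ (by positivity) (by positivity)]
  linarith

/-- Factor the difference of squares: the first factor is at most `A m(c)`, and `|c| m(c) ≤ 1`
absorbs the growth of the second. This is why admissible radii shrink like `1/|c|`. -/
theorem abs_norm_sq_sub_le {A : ℝ} (hA : 0 ≤ A) {x c : E n} (h : dist x c ≤ A * m c) :
    |‖x‖ ^ 2 - ‖c‖ ^ 2| ≤ 2 * A + A ^ 2 := by
  have h0 : |‖x‖ - ‖c‖| ≤ A * m c :=
    (abs_norm_sub_norm_le x c).trans (by rwa [← dist_eq_norm])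
  have hm := m_pos c
  have hm1 := m_le_one c
  have hm2 := norm_mul_m_le_one c
  have h3 : ‖x‖ + ‖c‖ ≤ 2 * ‖c‖ + A * m c := by linarith [le_abs_self (‖x‖ - ‖c‖)]
  have h4 : |‖x‖ ^ 2 - ‖c‖ ^ 2| = |‖x‖ - ‖c‖| * (‖x‖ + ‖c‖) := by
    rw [sq_sub_sq, abs_mul, mul_comm, abs_of_nonneg (a := ‖x‖ + ‖c‖) (by positivity)]
  rw [h4]
  calc |‖x‖ - ‖c‖| * (‖x‖ + ‖c‖) ≤ (A * m c) * (2 * ‖c‖ + A * m c) := by gcongr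
    _ = 2 * A * (‖c‖ * m c) + A ^ 2 * (m c) ^ 2 := by ring
    _ ≤ 2 * A * 1 + A ^ 2 * 1 := by
        gcongr
        exact pow_le_one₀ hm.le hm1
    _ = _ := by ring

instance isFiniteMeasure_gauss : IsFiniteMeasure (gauss n) := by
  have h : Integrable (fun x : E n => Real.pi ^ (-(n : ℝ) / 2) * Real.exp (-‖x‖ ^ 2)) := by
    apply Integrable.const_mul
    have h0 : (∫ x : E n, Real.exp (-1 * ‖x‖ ^ 2)) ≠ 0 := by
      rw [GaussianFourier.integral_rexp_neg_mul_sq_norm one_pos]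
      positivity
    have h1 := not_imp_comm.1 integral_undef h0
    simpa using h1
  exact isFiniteMeasure_withDensity_ofReal h.2

theorem gauss_absolutelyContinuous : gauss n ≪ volume := withDensity_absolutelyContinuous _ _

theorem gauss_apply {s : Set (E n)} (hs : MeasurableSet s) :
    gauss n s = ∫⁻ x in s,
      ENNReal.ofReal (Real.pi ^ (-(n : ℝ) / 2) * Real.exp (-‖x‖ ^ 2)) := by
  rw [gauss, withDensity_apply _ hs]

/-- The Gauss measure is locally doubling: on an admissible ball, it is comparable to a multiple
of the Lebesgue measure. -/
theorem gauss_ball_le (n : ℕ) {A K : ℝ} (hA : 0 ≤ A) (hK : 0 < K) :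
    ∃ D : ℝ≥0, 0 < D ∧ ∀ (c c' : E n) (r r' : ℝ), 0 < r' → ball c' r' ⊆ ball c r →
      r ≤ A * m c → r ≤ K * r' → gauss n (ball c r) ≤ D * gauss n (ball c' r') := by
  set L := 2 * A + A ^ 2
  -- One factor `exp L` comes from bounding the density above by its value at `c`, one from bounding
  -- it below; `K ^ n` is the ratio of the volumes.
  refine ⟨(Real.exp (2 * L) * K ^ n).toNNReal, by simp; positivity, ?_⟩
  intro c c' r r' hr' hsub hr hrK
  set w := Real.pi ^ (-(n : ℝ) / 2) * Real.exp (-‖c‖ ^ 2)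
  have hw : 0 ≤ w := by positivity
  have key : ∀ x ∈ ball c r, |‖x‖ ^ 2 - ‖c‖ ^ 2| ≤ L := fun x hx =>
    abs_norm_sq_sub_le hA (hx.le.trans hr)
  have up : gauss n (ball c r) ≤ ENNReal.ofReal (w * Real.exp L) * volume (ball c r) := by
    rw [gauss_apply measurableSet_ball, ← setLIntegral_const]
    refine setLIntegral_mono measurable_const fun x hx => ENNReal.ofReal_le_ofReal ?_
    rw [mul_assoc, ← Real.exp_add]
    gcongr
    linarith [(abs_le.1 (key x hx)).1]
  have lo : ENNReal.ofReal (w * Real.exp (-L)) * volume (ball c' r') ≤ gauss n (ball c' r') := by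
    rw [gauss_apply measurableSet_ball, ← setLIntegral_const]
    refine setLIntegral_mono (by fun_prop) fun x hx => ENNReal.ofReal_le_ofReal ?_
    rw [mul_assoc, ← Real.exp_add]
    gcongr
    linarith [(abs_le.1 (key x (hsub hx))).2]
  have vol : volume (ball c r) ≤ ENNReal.ofReal (K ^ n) * volume (ball c' r') := by
    calc volume (ball c r) ≤ volume (ball c (K * r')) := measure_mono (ball_subset_ball hrK)
      _ = ENNReal.ofReal (K ^ n) * volume (ball c' r') := by
        rw [Measure.addHaar_ball_mul_of_pos _ _ hK, Measure.addHaar_ball_center _ c']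
        simp
  calc gauss n (ball c r)
      ≤ ENNReal.ofReal (w * Real.exp L) * (ENNReal.ofReal (K ^ n) * volume (ball c' r')) :=
        up.trans (by gcongr)
    _ = ENNReal.ofReal (Real.exp (2 * L) * K ^ n) *
        (ENNReal.ofReal (w * Real.exp (-L)) * volume (ball c' r')) := by
        rw [← mul_assoc, ← mul_assoc, ← ENNReal.ofReal_mul (by positivity),
          ← ENNReal.ofReal_mul (by positivity)]
        congr 2
        have : Real.exp L = Real.exp (2 * L) * Real.exp (-L) := by
          rw [← Real.exp_add]; ring_nf
        rw [this]; ring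
    _ ≤ _ := by
        rw [← ENNReal.ofReal]
        gcongr

theorem gauss_ball_pos (c : E n) {r : ℝ} (hr : 0 < r) : 0 < gauss n (ball c r) := by
  have : volume (ball c r) ≠ 0 := (measure_ball_pos volume c hr).ne'
  refine pos_iff_ne_zero.2 fun h => this ?_
  rw [gauss, withDensity_apply_eq_zero (by fun_prop)] at h
  refine measure_mono_null ?_ h
  refine fun x hx => ⟨?_, hx⟩
  simp only [mem_ofPred_eq, ne_eq, ENNReal.ofReal_eq_zero, not_le]
  positivity

theorem gauss_ball_ne_top (c : E n) (r : ℝ) : gauss n (ball c r) ≠ ∞ := measure_ne_top _ _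

theorem ball_ae_eq_closedBall_gauss (c : E n) {r : ℝ} (hr : 0 < r) :
    (ball c r : Set (E n)) =ᵐ[gauss n] closedBall c r := by
  refine gauss_absolutelyContinuous.ae_eq ?_
  rw [← ball_union_sphere]
  exact (union_ae_eq_left_of_ae_eq_empty
    (ae_eq_empty.2 (Measure.addHaar_sphere_of_ne_zero _ c hr.ne'))).symm

/-! ### Covering lemma and averages over balls -/

/-- Vitali's covering lemma for open balls, with a countable subfamily. -/
theorem exists_countable_vitali (t : Set (E n × ℝ)) (R : ℝ) (ht : ∀ p ∈ t, 0 < p.2 ∧ p.2 ≤ R) :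
    ∃ u ⊆ t, u.Countable ∧ (u.PairwiseDisjoint fun p => ball p.1 p.2) ∧
      ∀ p ∈ t, ∃ p' ∈ u, ball p.1 p.2 ⊆ ball p'.1 (5 * p'.2) := by
  obtain ⟨u, hut, hd, hc⟩ := Vitali.exists_disjoint_subfamily_covering_enlargement_ball t
    (fun p => p.1) (fun p => p.2) R (fun p hp => (ht p hp).2) 5 (by norm_num)
  exact ⟨u, hut, hd.countable_of_isOpen (fun _ _ => isOpen_ball)
    (fun p hp => nonempty_ball.2 (ht p (hut hp)).1), hd, hc⟩

/-- The average of `g` over the ball `B(c, r)` with respect to the Gauss measure. -/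
def av (c : E n) (r : ℝ) (g : E n → ℝ≥0∞) : ℝ≥0∞ :=
  (gauss n (ball c r))⁻¹ * ∫⁻ x in ball c r, g x ∂(gauss n)

theorem av_eq_lintegral (c : E n) (r : ℝ) (g : E n → ℝ≥0∞) :
    av c r g = ∫⁻ x, g x ∂((gauss n (ball c r))⁻¹ • (gauss n).restrict (ball c r)) := by
  rw [lintegral_smul_measure, smul_eq_mul, av]

theorem mul_av (c : E n) {r : ℝ} (hr : 0 < r) (g : E n → ℝ≥0∞) :
    gauss n (ball c r) * av c r g = ∫⁻ x in ball c r, g x ∂(gauss n) := by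
  rw [av, ← mul_assoc, ENNReal.mul_inv_cancel (gauss_ball_pos c hr).ne' (gauss_ball_ne_top c r),
    one_mul]

theorem av_const (c : E n) {r : ℝ} (hr : 0 < r) (k : ℝ≥0∞) : av c r (fun _ => k) = k := by
  rw [av, setLIntegral_const, mul_comm k, ← mul_assoc,
    ENNReal.inv_mul_cancel (gauss_ball_pos c hr).ne' (gauss_ball_ne_top c r), one_mul]

theorem av_mono_on {c : E n} {r : ℝ} {g h : E n → ℝ≥0∞} (H : ∀ x ∈ ball c r, g x ≤ h x) :
    av c r g ≤ av c r h := by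
  unfold av
  gcongr 1
  exact setLIntegral_mono' measurableSet_ball H

theorem av_congr_ae {c : E n} {r : ℝ} {g h : E n → ℝ≥0∞} (H : g =ᵐ[gauss n] h) :
    av c r g = av c r h := by
  unfold av
  congr 1
  exact lintegral_congr_ae (ae_restrict_of_ae H)

theorem av_add {c : E n} {r : ℝ} {g : E n → ℝ≥0∞} (hg : Measurable g) (h : E n → ℝ≥0∞) :
    av c r (fun x => g x + h x) = av c r g + av c r h := by
  unfold av
  rw [lintegral_add_left hg, mul_add]

/-- Hölder's inequality for averages. -/
theorem av_mul_le (c : E n) (r : ℝ) {s s' : ℝ} (hs : s'.HolderConjugate s)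
    {g u : E n → ℝ≥0∞} (hg : AEMeasurable g (gauss n)) (hu : AEMeasurable u (gauss n)) :
    av c r (fun x => g x * u x) ≤
      av c r (fun x => g x ^ s') ^ (1 / s') * av c r (fun x => u x ^ s) ^ (1 / s) := by
  simp only [av_eq_lintegral]
  exact ENNReal.lintegral_mul_le_Lp_mul_Lq _ hs
    (hg.restrict.smul_measure _) (hu.restrict.smul_measure _)

theorem av_le_rpow_av (c : E n) {r : ℝ} (hr : 0 < r) {s : ℝ} (hs : 1 ≤ s)
    {u : E n → ℝ≥0∞} (hu : AEMeasurable u (gauss n)) :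
    av c r u ≤ av c r (fun x => u x ^ s) ^ (1 / s) := by
  rcases hs.eq_or_lt with rfl | hs
  · simp
  have := av_mul_le c r (Real.HolderConjugate.conjExponent hs).symm
    (aemeasurable_const (b := (1 : ℝ≥0∞))) hu
  simpa [av_const c hr] using this

/-- The average over a ball is controlled by the average over a comparable larger ball. -/
theorem av_le_av_of_subset (n : ℕ) {A K : ℝ} (hA : 0 ≤ A) (hK : 0 < K) :
    ∃ D : ℝ≥0, 0 < D ∧ ∀ (c c' : E n) (r r' : ℝ), 0 < r' → ball c' r' ⊆ ball c r →
      r ≤ A * m c → r ≤ K * r' → ∀ g : E n → ℝ≥0∞, av c' r' g ≤ D * av c r g := by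
  obtain ⟨D, hD, h⟩ := gauss_ball_le n hA hK
  refine ⟨D, hD, fun c c' r r' hr' hsub hr hrK g => ?_⟩
  have h1 := h c c' r r' hr' hsub hr hrK
  have hpos := gauss_ball_pos c' hr'
  have hpos2 : 0 < gauss n (ball c r) := hpos.trans_le (measure_mono hsub)
  unfold av
  rw [← mul_assoc]
  gcongr
  rw [ENNReal.inv_le_iff_le_mul (by simp [hpos.ne']) (by simp),
    ← mul_assoc, mul_comm _ (D : ℝ≥0∞), ← div_eq_mul_inv,
    ENNReal.le_div_iff_mul_le (by simp [hpos2.ne']) (by simp), one_mul]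
  exact h1

/-! ### Dyadic level sums -/

/-- The dyadic level sum `∑_{k ∈ ℤ, 2^k < h} 2^{kr}`, which is comparable to `h^r`. -/
def levelSum (r : ℝ) (h : ℝ≥0∞) : ℝ≥0∞ :=
  ∑' k : ℤ, if (2 : ℝ≥0∞) ^ k < h then ((2 : ℝ≥0∞) ^ k) ^ r else 0

theorem two_zpow_rpow (k : ℤ) (r : ℝ) : ((2 : ℝ≥0∞) ^ k) ^ r = (2 : ℝ≥0∞) ^ (k * r : ℝ) := by
  rw [← ENNReal.rpow_intCast, ENNReal.rpow_mul]

theorem two_zpow_pos (k : ℤ) : (0 : ℝ≥0∞) < (2 : ℝ≥0∞) ^ k :=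
  ENNReal.zpow_pos (by norm_num) (by norm_num) k

theorem two_zpow_ne_top (k : ℤ) : (2 : ℝ≥0∞) ^ k ≠ ∞ :=
  ENNReal.zpow_ne_top (by norm_num) (by norm_num) k

theorem two_zpow_succ (k : ℤ) : (2 : ℝ≥0∞) ^ (k + 1) = 2 * (2 : ℝ≥0∞) ^ k := by
  rw [ENNReal.zpow_add (by norm_num) (by norm_num), zpow_one, mul_comm]

/-- The sum is geometric with ratio `2^(-r)` below its top term, which is less than `h^r`. -/
theorem levelSum_le {r : ℝ} (hr : 0 < r) :
    ∃ C : ℝ≥0, 0 < C ∧ ∀ h : ℝ≥0∞, levelSum r h ≤ C * h ^ r := by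
  have hlt : (2 : ℝ≥0∞) ^ (-r) < 1 := by
    rw [ENNReal.rpow_neg, ENNReal.inv_lt_one]
    exact ENNReal.one_lt_rpow (by norm_num) hr
  set C := (1 - (2 : ℝ≥0∞) ^ (-r))⁻¹ with hC
  have hCtop : C ≠ ∞ := ENNReal.inv_ne_top.2 (tsub_pos_of_lt hlt).ne'
  have hC0 : C ≠ 0 := ENNReal.inv_ne_zero.2 (by simp)
  refine ⟨C.toNNReal, ENNReal.toNNReal_pos hC0 hCtop, fun h => ?_⟩
  rw [ENNReal.coe_toNNReal hCtop]
  rcases eq_or_ne h 0 with rfl | h0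
  · simp [levelSum]
  rcases eq_or_ne h ∞ with rfl | ht
  · simp [ENNReal.top_rpow_of_pos hr, ENNReal.mul_top hC0]
  obtain ⟨N, hN⟩ := ENNReal.exists_mem_Ioc_zpow h0 ht (y := 2) (by norm_num) (by norm_num)
  have hinj : Function.Injective (fun j : ℕ => N - (j : ℤ)) := fun i j hij => by
    simpa using hij
  have hk : ∀ k : ℤ, (2 : ℝ≥0∞) ^ k < h → k ≤ N := fun k hk => by
    by_contra! hcon
    have : (2 : ℝ≥0∞) ^ (N + 1) ≤ 2 ^ k := ENNReal.zpow_le_of_le (by norm_num) (by omega)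
    exact absurd (hN.2.trans this) (not_le.2 hk)
  have : levelSum r h ≤ ∑' j : ℕ, ((2 : ℝ≥0∞) ^ (N - (j : ℤ))) ^ r := by
    unfold levelSum
    rw [← hinj.tsum_eq]
    · refine ENNReal.tsum_le_tsum fun j => ?_
      split_ifs <;> simp
    · intro k hk'
      have hkN := hk k (by by_contra hcon; simp [hcon] at hk')
      exact ⟨(N - k).toNat, by simp; omega⟩
  refine this.trans ?_
  have hterm : ∀ j : ℕ, ((2 : ℝ≥0∞) ^ (N - (j : ℤ))) ^ r =
      ((2 : ℝ≥0∞) ^ N) ^ r * ((2 : ℝ≥0∞) ^ (-r)) ^ j := fun j => by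
    rw [two_zpow_rpow, two_zpow_rpow, ← ENNReal.rpow_natCast, ← ENNReal.rpow_mul,
      ← ENNReal.rpow_add _ _ (by norm_num) (by norm_num)]
    congr 1
    push_cast
    ring
  simp_rw [hterm]
  rw [ENNReal.tsum_mul_left, ENNReal.tsum_geometric, mul_comm]
  gcongr
  exact hN.1.le

theorem levelSum_top {r : ℝ} (hr : 0 < r) : levelSum r ∞ = ∞ := by
  rw [eq_top_iff]
  refine (ENNReal.tsum_const_eq_top_of_ne_zero (α := ℕ) one_ne_zero).ge.trans ?_
  refine le_trans (ENNReal.tsum_le_tsum fun j => ?_)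
    (ENNReal.tsum_comp_le_tsum_of_injective Nat.cast_injective _)
  rw [if_pos (two_zpow_ne_top _).lt_top, two_zpow_rpow]
  simpa using ENNReal.rpow_le_rpow_of_exponent_le (x := 2) (by norm_num)
    (show 0 ≤ ((j : ℤ) : ℝ) * r by positivity)

theorem rpow_le_levelSum {r : ℝ} (hr : 0 < r) (h : ℝ≥0∞) :
    h ^ r ≤ 2 ^ r * levelSum r h := by
  rcases eq_or_ne h ∞ with rfl | ht
  · simp [levelSum_top hr, ENNReal.mul_top, hr]
  rcases eq_or_ne h 0 with rfl | h0
  · simp [hr]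
  obtain ⟨N, hN⟩ := ENNReal.exists_mem_Ioc_zpow h0 ht (y := 2) (by norm_num) (by norm_num)
  calc h ^ r ≤ ((2 : ℝ≥0∞) ^ (N + 1)) ^ r := by gcongr; exact hN.2
    _ = 2 ^ r * ((2 : ℝ≥0∞) ^ N) ^ r := by
      rw [two_zpow_succ, ENNReal.mul_rpow_of_nonneg _ _ hr.le]
    _ ≤ _ := by
      gcongr
      unfold levelSum
      refine le_trans ?_ (ENNReal.le_tsum N)
      rw [if_pos hN.1]

theorem lintegral_levelSum {α : Type*} [MeasurableSpace α] (μ : Measure α) (r : ℝ)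
    {h : α → ℝ≥0∞} (hh : Measurable h) :
    ∫⁻ x, levelSum r (h x) ∂μ = ∑' k : ℤ, ((2 : ℝ≥0∞) ^ k) ^ r * μ {x | (2 : ℝ≥0∞) ^ k < h x} := by
  have hm : ∀ k : ℤ, MeasurableSet {x | (2 : ℝ≥0∞) ^ k < h x} := fun k =>
    measurableSet_lt measurable_const hh
  unfold levelSum
  rw [lintegral_tsum fun k => (Measurable.ite (hm k) measurable_const measurable_const).aemeasurable]
  refine tsum_congr fun k => ?_
  rw [← lintegral_indicator_const (hm k)]
  refine lintegral_congr fun x => ?_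
  by_cases hx : (2 : ℝ≥0∞) ^ k < h x <;> simp [hx]

/-! ### The local maximal function -/

/-- The local uncentred maximal function, over the balls of `𝓑_A`. -/
def maxFun (A : ℝ) (g : E n → ℝ≥0∞) (x : E n) : ℝ≥0∞ :=
  ⨆ (c : E n) (r : ℝ) (_ : Admissible A c r) (_ : x ∈ ball c r), av c r g

theorem av_le_maxFun {A : ℝ} {g : E n → ℝ≥0∞} {x c : E n} {r : ℝ} (h : Admissible A c r)
    (hx : x ∈ ball c r) : av c r g ≤ maxFun A g x :=
  le_iSup_of_le c <| le_iSup_of_le r <| le_iSup_of_le h <| le_iSup_of_le hx le_rfl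

theorem lt_maxFun_iff {A : ℝ} {g : E n → ℝ≥0∞} {x : E n} {t : ℝ≥0∞} :
    t < maxFun A g x ↔ ∃ c r, Admissible A c r ∧ x ∈ ball c r ∧ t < av c r g := by
  simp only [maxFun, lt_iSup_iff, exists_prop]

theorem measurable_maxFun (A : ℝ) (g : E n → ℝ≥0∞) : Measurable (maxFun A g) := by
  refine measurable_of_Ioi fun t => IsOpen.measurableSet ?_
  have : maxFun A g ⁻¹' Ioi t =
      ⋃ p ∈ {p : E n × ℝ | Admissible A p.1 p.2 ∧ t < av p.1 p.2 g}, ball p.1 p.2 := by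
    ext x
    simp only [mem_preimage, mem_Ioi, lt_maxFun_iff, mem_iUnion, mem_ofPred_eq, Prod.exists,
      exists_prop]
    exact exists_congr fun c => exists_congr fun r => by tauto
  rw [this]
  exact isOpen_biUnion fun _ _ => isOpen_ball

theorem admissible_le {A : ℝ} {c : E n} {r : ℝ} (hA : 0 ≤ A) (h : Admissible A c r) : r ≤ A :=
  h.2.trans (mul_le_of_le_one_right hA (m_le_one c))

theorem Admissible.mul {A k : ℝ} {c : E n} {r : ℝ} (hk : 0 < k) (h : Admissible A c r) :
    Admissible (k * A) c (k * r) :=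
  ⟨mul_pos hk h.1, by rw [mul_assoc]; exact mul_le_mul_of_nonneg_left h.2 hk.le⟩

theorem gauss_ball_five_le (n : ℕ) {A : ℝ} (hA : 0 ≤ A) :
    ∃ D : ℝ≥0, 0 < D ∧ ∀ (c : E n) (r : ℝ), Admissible A c r →
      gauss n (ball c (5 * r)) ≤ D * gauss n (ball c r) := by
  obtain ⟨D, hD, h⟩ := gauss_ball_le n (A := 5 * A) (K := 5) (by positivity) (by norm_num)
  refine ⟨D, hD, fun c r hr => h c c (5 * r) r hr.1 (ball_subset_ball (by linarith [hr.1]))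
    (hr.mul (by norm_num)).2 le_rfl⟩

/-- The weak type `(1, 1)` inequality. -/
theorem maxFun_weak (n : ℕ) {A : ℝ} (hA : 0 ≤ A) :
    ∃ D : ℝ≥0, 0 < D ∧ ∀ (g : E n → ℝ≥0∞) (t : ℝ≥0∞),
      t * gauss n {x | t < maxFun A g x} ≤ D * ∫⁻ x, g x ∂(gauss n) := by
  obtain ⟨D, hD, hDb⟩ := gauss_ball_five_le n hA
  refine ⟨D, hD, fun g t => ?_⟩
  obtain ⟨u, hut, huc, hud, hcov⟩ := exists_countable_vitali
    {p : E n × ℝ | Admissible A p.1 p.2 ∧ t < av p.1 p.2 g} A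
    (fun p hp => ⟨hp.1.1, admissible_le hA hp.1⟩)
  have hsub : {x | t < maxFun A g x} ⊆ ⋃ p ∈ u, ball p.1 (5 * p.2) := by
    intro x hx
    obtain ⟨c, r, h1, h2, h3⟩ := lt_maxFun_iff.1 hx
    obtain ⟨p, hp, hp'⟩ := hcov (c, r) ⟨h1, h3⟩
    exact mem_biUnion hp (hp' h2)
  calc t * gauss n {x | t < maxFun A g x}
      ≤ t * ∑' p : u, gauss n (ball p.1.1 (5 * p.1.2)) := by
        gcongr
        exact (measure_mono hsub).trans (measure_biUnion_le _ huc _)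
    _ ≤ t * ∑' p : u, D * gauss n (ball p.1.1 p.1.2) := by
        gcongr with p
        exact hDb _ _ (hut p.2).1
    _ = D * ∑' p : u, gauss n (ball p.1.1 p.1.2) * t := by
        rw [ENNReal.tsum_mul_left, ENNReal.tsum_mul_right]; ring
    _ ≤ D * ∑' p : u, ∫⁻ x in ball p.1.1 p.1.2, g x ∂(gauss n) := by
        gcongr with p
        rw [← mul_av _ (hut p.2).1.1]
        gcongr
        exact (hut p.2).2.le
    _ = D * ∫⁻ x in ⋃ p ∈ u, ball p.1 p.2, g x ∂(gauss n) := by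
        rw [lintegral_biUnion huc (fun _ _ => measurableSet_ball) hud]
    _ ≤ _ := by
        gcongr
        exact Measure.restrict_le_self

/-- The part of `g` below height `t` adds at most `t` to any average. This truncation is the
interpolation step between the weak type `(1, 1)` and the trivial `L^∞` bound. -/
theorem maxFun_le_add {A : ℝ} (g : E n → ℝ≥0∞) (t : ℝ≥0∞) (x : E n) :
    maxFun A g x ≤ t + maxFun A (indicator {y | t < g y} g) x := by
  refine iSup_le fun c => iSup_le fun r => iSup_le fun h => iSup_le fun hx => ?_
  calc av c r g ≤ av c r (fun y => t + indicator {y | t < g y} g y) := by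
        refine av_mono_on fun y _ => ?_
        by_cases hy : t < g y
        · simp [hy]
        · simpa [hy] using not_lt.1 hy
    _ = t + av c r (indicator {y | t < g y} g) := by
        rw [av_add measurable_const, av_const c h.1]
    _ ≤ _ := by gcongr; exact av_le_maxFun h hx

/-- The strong type `(r, r)` inequality, for `r > 1`. -/
theorem maxFun_strong (n : ℕ) {A : ℝ} (hA : 0 ≤ A) {r : ℝ} (hr : 1 < r) :
    ∃ D : ℝ≥0, 0 < D ∧ ∀ g : E n → ℝ≥0∞, Measurable g →
      ∫⁻ x, maxFun A g x ^ r ∂(gauss n) ≤ D * ∫⁻ x, g x ^ r ∂(gauss n) := by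
  obtain ⟨D, hD, hw⟩ := maxFun_weak n hA
  -- Summing the weak type bounds over the levels leaves a level sum of exponent `r - 1`, which
  -- converges because `r > 1`.
  obtain ⟨C, hC, hl⟩ := levelSum_le (r := r - 1) (by linarith)
  refine ⟨(2 : ℝ≥0) ^ r * (2 * D) * (C * (2 : ℝ≥0) ^ (r - 1)), by positivity, fun g hg => ?_⟩
  have hlev : ∀ k : ℤ, ((2 : ℝ≥0∞) ^ k) ^ r * gauss n {x | (2 : ℝ≥0∞) ^ k < maxFun A g x} ≤
      2 * D * ∫⁻ x, g x * (if (2 : ℝ≥0∞) ^ k < 2 * g x then ((2 : ℝ≥0∞) ^ k) ^ (r - 1) else 0)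
        ∂(gauss n) := fun k => by
    -- Truncating at half the level leaves the other half to the maximal function of the large part
    -- of `g`.
    set t : ℝ≥0∞ := (2 : ℝ≥0∞) ^ (k - 1) with ht
    have htk : (2 : ℝ≥0∞) ^ k = 2 * t := by rw [ht, ← two_zpow_succ]; simp
    have hsub : {x | (2 : ℝ≥0∞) ^ k < maxFun A g x} ⊆
        {x | t < maxFun A (indicator {y | t < g y} g) x} := fun x hx => by
      have := (show (2 : ℝ≥0∞) ^ k < maxFun A g x from hx).trans_le (maxFun_le_add g t x)
      rw [htk, two_mul] at this
      exact lt_of_add_lt_add_left this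
    calc ((2 : ℝ≥0∞) ^ k) ^ r * gauss n {x | (2 : ℝ≥0∞) ^ k < maxFun A g x}
        = ((2 : ℝ≥0∞) ^ k) ^ (r - 1) * (2 * (t * gauss n {x | (2 : ℝ≥0∞) ^ k < maxFun A g x})) := by
          rw [← mul_assoc 2, ← htk, ← mul_assoc]
          congr 1
          nth_rw 3 [← ENNReal.rpow_one ((2 : ℝ≥0∞) ^ k)]
          rw [← ENNReal.rpow_add _ _ (two_zpow_pos k).ne' (two_zpow_ne_top k)]
          simp
      _ ≤ ((2 : ℝ≥0∞) ^ k) ^ (r - 1) *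
          (2 * (D * ∫⁻ x, indicator {y | t < g y} g x ∂(gauss n))) := by
          gcongr ((2 : ℝ≥0∞) ^ k) ^ (r - 1) * (2 * ?_)
          exact le_trans (by gcongr) (hw _ t)
      _ = 2 * D * ∫⁻ x, ((2 : ℝ≥0∞) ^ k) ^ (r - 1) * indicator {y | t < g y} g x ∂(gauss n) := by
          rw [lintegral_const_mul _ (hg.indicator (measurableSet_lt measurable_const hg))]
          ring
      _ = _ := by
          congr 1
          refine lintegral_congr fun x => ?_
          have : (2 : ℝ≥0∞) ^ k < 2 * g x ↔ t < g x := by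
            rw [htk]
            exact ENNReal.mul_lt_mul_iff_right (by norm_num) (by norm_num)
          rw [if_congr this rfl rfl, mul_comm]
          by_cases hx : t < g x <;> simp [hx]
  have hmeas : ∀ k : ℤ, Measurable fun x => g x *
      (if (2 : ℝ≥0∞) ^ k < 2 * g x then ((2 : ℝ≥0∞) ^ k) ^ (r - 1) else 0) := fun k =>
    hg.mul (Measurable.ite (measurableSet_lt measurable_const (hg.const_mul 2))
      measurable_const measurable_const)
  calc ∫⁻ x, maxFun A g x ^ r ∂(gauss n)
      ≤ ∫⁻ x, 2 ^ r * levelSum r (maxFun A g x) ∂(gauss n) :=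
        lintegral_mono fun x => rpow_le_levelSum (by linarith) _
    _ = 2 ^ r * ∑' k : ℤ, ((2 : ℝ≥0∞) ^ k) ^ r *
          gauss n {x | (2 : ℝ≥0∞) ^ k < maxFun A g x} := by
        rw [lintegral_const_mul' _ _ (ENNReal.rpow_ne_top_of_nonneg (by linarith) (by norm_num)),
          lintegral_levelSum _ _ (measurable_maxFun A g)]
    _ ≤ 2 ^ r * ∑' k : ℤ, 2 * D * ∫⁻ x, g x *
          (if (2 : ℝ≥0∞) ^ k < 2 * g x then ((2 : ℝ≥0∞) ^ k) ^ (r - 1) else 0) ∂(gauss n) := by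
        gcongr 2 ^ r * ∑' k : ℤ, ?_ with k
        exact hlev k
    _ = 2 ^ r * (2 * D) * ∫⁻ x, g x * levelSum (r - 1) (2 * g x) ∂(gauss n) := by
        rw [ENNReal.tsum_mul_left, ← lintegral_tsum fun k => (hmeas k).aemeasurable, ← mul_assoc]
        simp_rw [ENNReal.tsum_mul_left]
        simp only [levelSum]
    _ ≤ 2 ^ r * (2 * D) * ∫⁻ x, (C * 2 ^ (r - 1)) * g x ^ r ∂(gauss n) := by
        gcongr 2 ^ r * (2 * D) * ?_
        refine lintegral_mono fun x => ?_
        calc g x * levelSum (r - 1) (2 * g x) ≤ g x * (C * (2 * g x) ^ (r - 1)) := by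
              gcongr; exact hl _
          _ = C * 2 ^ (r - 1) * (g x ^ (1 : ℝ) * g x ^ (r - 1)) := by
              rw [ENNReal.mul_rpow_of_nonneg _ _ (by linarith), ENNReal.rpow_one]; ring
          _ = _ := by
              rw [← ENNReal.rpow_add_of_nonneg _ _ zero_le_one (by linarith)]
              simp
    _ = _ := by
        rw [lintegral_const_mul _ (hg.pow_const r), ← mul_assoc]
        push_cast
        rw [ENNReal.coe_rpow_of_nonneg _ (by linarith), ENNReal.coe_rpow_of_nonneg _ (by linarith)]
        simp

/-! ### Mean oscillation and change of scale -/

/-- The mean value of `b` over the ball `B(c, r)`. -/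
abbrev mean (b : E n → 𝕜) (c : E n) (r : ℝ) : 𝕜 := ⨍ y in ball c r, b y ∂(gauss n)

theorem meanOsc_eq_av (b : E n → 𝕜) (c : E n) (r : ℝ) :
    meanOsc b c r = av c r fun x => ‖b x - mean b c r‖ₑ := rfl

theorem enorm_mean_sub_le {b : E n → 𝕜} (hb : Integrable b (gauss n)) (c : E n) {r : ℝ}
    (hr : 0 < r) (κ : 𝕜) : ‖mean b c r - κ‖ₑ ≤ av c r fun x => ‖b x - κ‖ₑ := by
  set ν := (gauss n (ball c r))⁻¹ • (gauss n).restrict (ball c r) with hν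
  have hp : IsProbabilityMeasure ν := ⟨by
    simp [hν, ENNReal.inv_mul_cancel (gauss_ball_pos c hr).ne' (gauss_ball_ne_top c r)]⟩
  have hi : Integrable b ν := hb.restrict.smul_measure
    (ENNReal.inv_ne_top.2 (gauss_ball_pos c hr).ne')
  have : mean b c r - κ = ∫ x, (b x - κ) ∂ν := by
    rw [integral_sub hi (integrable_const _), mean, setAverage_eq', integral_const, probReal_univ,
      one_smul]
  rw [this, av_eq_lintegral]
  exact enorm_integral_le_lintegral_enorm _

theorem av_sub_le {b : E n → 𝕜} (hb : Measurable b) (c : E n) {r : ℝ} (hr : 0 < r) (κ κ' : 𝕜) :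
    av c r (fun x => ‖b x - κ'‖ₑ) ≤ av c r (fun x => ‖b x - κ‖ₑ) + ‖κ - κ'‖ₑ := by
  calc av c r (fun x => ‖b x - κ'‖ₑ) ≤ av c r (fun x => ‖b x - κ‖ₑ + ‖κ - κ'‖ₑ) := by
        refine av_mono_on fun x _ => ?_
        rw [← sub_add_sub_cancel (b x) κ κ']
        exact enorm_add_le _ _
    _ = _ := by rw [av_add (by fun_prop), av_const c hr]

theorem meanOsc_le_two_mul {b : E n → 𝕜} (hb : Integrable b (gauss n)) (hbm : Measurable b)
    (c : E n) {r : ℝ} (hr : 0 < r) (κ : 𝕜) :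
    meanOsc b c r ≤ 2 * av c r fun x => ‖b x - κ‖ₑ := by
  rw [meanOsc_eq_av, two_mul]
  refine (av_sub_le hbm c hr κ _).trans ?_
  gcongr
  rw [enorm_sub_rev]
  exact enorm_mean_sub_le hb c hr κ

/-- Control of the mean oscillations at one admissible scale gives control at every admissible
scale. -/
theorem meanOsc_le_of_admissible (n : ℕ) {a A : ℝ} (ha : 0 < a) (hA : 0 < A) :
    ∃ C : ℝ≥0, 0 < C ∧ ∀ (b : E n → 𝕜), Measurable b → Integrable b (gauss n) → ∀ N : ℝ≥0∞,
      (∀ c r, Admissible a c r → meanOsc b c r ≤ N) →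
      ∀ c r, Admissible A c r → meanOsc b c r ≤ C * N := by
  obtain ⟨D₁, hD₁, h₁⟩ := av_le_av_of_subset n ha.le (K := 2) (by norm_num)
  obtain ⟨D₅, hD₅, h₅⟩ := gauss_ball_five_le n ha.le
  obtain ⟨D₂, hD₂, h₂⟩ := gauss_ball_le n (A := 2 * A) (by positivity) (K := 2) (by norm_num)
  -- Since `m c ≤ (1 + A) m x` for `x` in the ball, this makes balls centred there of radius up to
  -- `2τr` belong to `𝓑_a`.
  set τ := min 1 (a / (2 * A * (1 + A))) with hτ
  have hτ0 : 0 < τ := by positivity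
  have hτ1 : τ ≤ 1 := min_le_left _ _
  have hτa : 2 * τ * A * (1 + A) ≤ a := by
    have : τ ≤ a / (2 * A * (1 + A)) := min_le_right _ _
    rw [le_div_iff₀ (by positivity)] at this
    linarith
  -- Enough steps of length `ρ = τr` to reach any point of the ball from its centre.
  set k₀ := ⌈1 / τ⌉₊
  have hk₀ : 1 ≤ k₀ * τ := by
    have := Nat.le_ceil (1 / τ)
    rwa [div_le_iff₀ hτ0] at this
  refine ⟨2 * ((1 + k₀ * (2 * D₁)) * D₅ * D₂), by positivity, fun b hbm hb N hN c r hcr => ?_⟩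
  have hr := hcr.1
  set ρ := τ * r with hρ
  have hρ0 : 0 < ρ := by positivity
  have hρr : ρ ≤ r := by nlinarith
  have adm : ∀ x, dist x c ≤ r → ∀ s, 0 < s → s ≤ 2 * ρ → Admissible a x s := by
    intro x hx s hs hsρ
    refine ⟨hs, hsρ.trans ?_⟩
    have hm := m_le_of_dist_le hA.le (hx.trans hcr.2)
    calc 2 * ρ = 2 * τ * r := by ring
      _ ≤ 2 * τ * (A * ((1 + A) * m x)) := by
        gcongr
        exact hcr.2.trans (by gcongr)
      _ = 2 * τ * A * (1 + A) * m x := by ring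
      _ ≤ a * m x := by gcongr; exact (m_pos x).le
  have step : ∀ x x', dist x c ≤ r → dist x' x ≤ ρ →
      ‖mean b x ρ - mean b x' ρ‖ₑ ≤ 2 * D₁ * N := by
    intro x x' hx hxx'
    have ad := adm x hx (2 * ρ) (by positivity) le_rfl
    -- Both neighbouring balls of radius `ρ` lie in `B(x, 2ρ)`, so their means are compared through
    -- its mean.
    have key : ∀ y, dist y x ≤ ρ → ‖mean b y ρ - mean b x (2 * ρ)‖ₑ ≤ D₁ * N := fun y hy =>
      (enorm_mean_sub_le hb y hρ0 _).trans <|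
        (h₁ x y (2 * ρ) ρ hρ0 (ball_subset_ball' (by linarith)) ad.2 le_rfl _).trans <| by
          gcongr; exact hN _ _ ad
    rw [← sub_sub_sub_cancel_right _ _ (mean b x (2 * ρ))]
    exact (enorm_sub_le.trans (add_le_add (key x (by simp [hρ0.le])) (key x' hxx'))).trans_eq
      (by ring)
  have chain : ∀ (k : ℕ) (x : E n), dist x c ≤ k * ρ → dist x c ≤ r →
      ‖mean b x ρ - mean b c ρ‖ₑ ≤ k * (2 * D₁ * N) := by
    intro k
    induction k with
    | zero =>
      intro x hx _
      have : x = c := dist_le_zero.1 (by simpa using hx)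
      simp [this]
    | succ k ih =>
      intro x hx hxr
      -- The intermediate point divides the segment from `c` to `x` so that it is within `kρ` of `c`
      -- and within `ρ` of `x`.
      set θ : ℝ := k / (k + 1)
      have hθ0 : 0 ≤ θ := by positivity
      have hθ1 : 1 - θ = 1 / (k + 1) := by simp only [θ]; field_simp; ring
      set x' := c + θ • (x - c)
      have d1 : dist x' c = θ * dist x c := by
        simp [x', dist_eq_norm, norm_smul, abs_of_nonneg hθ0]
      have d2 : dist x' x = (1 - θ) * dist x c := by
        have : x' - x = -((1 - θ) • (x - c)) := by simp only [x']; module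
        rw [dist_eq_norm, this, norm_neg, norm_smul, dist_eq_norm, Real.norm_of_nonneg]
        rw [hθ1]; positivity
      push_cast at hx
      have e1 : dist x' c ≤ k * ρ := by
        rw [d1]
        calc θ * dist x c ≤ θ * ((k + 1) * ρ) := by gcongr
          _ = k * ρ := by simp only [θ]; field_simp
      have e2 : dist x' x ≤ ρ := by
        rw [d2, hθ1, one_div, inv_mul_le_iff₀ (by positivity)]
        exact hx
      have e3 : dist x' c ≤ r := by
        rw [d1]
        have : θ ≤ 1 := by
          have : 0 ≤ 1 - θ := by rw [hθ1]; positivity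
          linarith
        nlinarith [dist_nonneg (x := x) (y := c)]
      rw [← sub_add_sub_cancel _ (mean b x' ρ)]
      refine (enorm_add_le _ _).trans ?_
      push_cast
      rw [add_mul, one_mul, add_comm]
      gcongr
      · exact ih x' e1 e3
      · exact step x x' hxr e2
  set κ := mean b c ρ
  set M : ℝ≥0∞ := (1 + k₀ * (2 * D₁)) * N with hM
  have loc : ∀ x, dist x c ≤ r →
      ∫⁻ y in ball x ρ, ‖b y - κ‖ₑ ∂(gauss n) ≤ M * gauss n (ball x ρ) := by
    intro x hx
    rw [← mul_av x hρ0, mul_comm]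
    gcongr
    refine (av_sub_le hbm x hρ0 (mean b x ρ) κ).trans ?_
    rw [hM, add_mul, one_mul, mul_assoc]
    gcongr
    · exact hN x ρ (adm x hx ρ hρ0 (by linarith))
    · refine chain k₀ x (hx.trans ?_) hx
      rw [hρ, ← mul_assoc]
      nlinarith
  -- Radius `ρ / 5` makes the dilates have radius exactly `ρ`, where `loc` applies, while the
  -- disjoint balls stay inside `B(c, 2r)`.
  obtain ⟨u, hut, huc, hud, hcov⟩ := exists_countable_vitali
    {p : E n × ℝ | dist p.1 c < r ∧ p.2 = ρ / 5} (ρ / 5)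
    (fun p hp => ⟨hp.2 ▸ by positivity, hp.2.le⟩)
  have hsub : ball c r ⊆ ⋃ p ∈ u, ball p.1 (5 * p.2) := fun x hx => by
    obtain ⟨p, hp, hp'⟩ := hcov (x, ρ / 5) ⟨hx, rfl⟩
    exact mem_biUnion hp (hp' (mem_ball_self (by positivity)))
  have h5 : ∀ p ∈ u, 5 * p.2 = ρ := fun p hp => by rw [(hut hp).2]; ring
  have total : ∫⁻ y in ball c r, ‖b y - κ‖ₑ ∂(gauss n) ≤ M * D₅ * D₂ * gauss n (ball c r) := by
    calc ∫⁻ y in ball c r, ‖b y - κ‖ₑ ∂(gauss n)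
        ≤ ∫⁻ y in ⋃ p ∈ u, ball p.1 (5 * p.2), ‖b y - κ‖ₑ ∂(gauss n) :=
          lintegral_mono_set hsub
      _ ≤ ∑' p : u, ∫⁻ y in ball p.1.1 (5 * p.1.2), ‖b y - κ‖ₑ ∂(gauss n) := by
          have := huc.to_subtype
          rw [biUnion_eq_iUnion]
          exact lintegral_iUnion_le _ _
      _ ≤ ∑' p : u, M * (D₅ * gauss n (ball p.1.1 p.1.2)) := by
          gcongr ∑' p : u, ?_ with p
          have hp := hut p.2
          rw [h5 p p.2]
          refine (loc _ hp.1.le).trans ?_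
          rw [← h5 p p.2]
          gcongr
          exact h₅ _ _ (adm _ hp.1.le _ (by rw [hp.2]; positivity) (by rw [hp.2]; linarith))
      _ = M * D₅ * gauss n (⋃ p ∈ u, ball p.1 p.2) := by
          rw [measure_biUnion huc hud fun _ _ => measurableSet_ball, ENNReal.tsum_mul_left,
            ENNReal.tsum_mul_left]
          ring
      _ ≤ M * D₅ * gauss n (ball c (2 * r)) := by
          gcongr
          refine iUnion₂_subset fun p hp => ball_subset_ball' ?_
          have := (hut hp).1
          rw [(hut hp).2]
          linarith
      _ ≤ M * D₅ * (D₂ * gauss n (ball c r)) := by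
          gcongr
          exact h₂ c c (2 * r) r hr (ball_subset_ball (by linarith)) (hcr.mul (by norm_num)).2 le_rfl
      _ = _ := by ring
  refine (meanOsc_le_two_mul hb hbm c hr κ).trans ?_
  calc 2 * av c r (fun x => ‖b x - κ‖ₑ)
      ≤ 2 * ((gauss n (ball c r))⁻¹ * (M * D₅ * D₂ * gauss n (ball c r))) := by
        unfold av; gcongr
    _ = 2 * (M * D₅ * D₂ * ((gauss n (ball c r))⁻¹ * gauss n (ball c r))) := by ring
    _ = _ := by
        rw [ENNReal.inv_mul_cancel (gauss_ball_pos c hr).ne' (gauss_ball_ne_top c r), hM]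
        push_cast
        ring

/-! ### John–Nirenberg inequality and moments of the oscillation -/

/-- Lebesgue differentiation along Besicovitch's closed balls; spheres are null, so open balls have
the same averages. -/
theorem ae_tendsto_av {g : E n → ℝ≥0∞} (hg : Measurable g) (h : ∫⁻ x, g x ∂(gauss n) ≠ ∞) :
    ∀ᵐ x ∂(gauss n), Tendsto (fun r => av x r g) (𝓝[>] 0) (𝓝 (g x)) := by
  filter_upwards [(Besicovitch.vitaliFamily (gauss n)).ae_tendsto_lintegral_div hg.aemeasurable h]
    with x hx
  refine (hx.comp (Besicovitch.tendsto_filterAt (gauss n) x)).congr' ?_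
  filter_upwards [self_mem_nhdsWithin] with r hr
  have hae := ball_ae_eq_closedBall_gauss x hr
  simp only [Function.comp, av]
  rw [setLIntegral_congr hae, measure_congr hae, div_eq_mul_inv, mul_comm]

/-- The John–Nirenberg inequality on admissible balls, at the levels `kΛ`. -/
theorem john_nirenberg (n : ℕ) {a : ℝ} (ha : 0 < a) (N : ℝ≥0) :
    ∃ Λ : ℝ≥0, 0 < Λ ∧ ∀ b : E n → 𝕜, Measurable b → Integrable b (gauss n) →
      (∀ c r, Admissible (2 * a) c r → meanOsc b c r ≤ N) →
      ∀ (k : ℕ) c r, Admissible a c r →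
        gauss n {x ∈ ball c r | k * (Λ : ℝ≥0∞) < ‖b x - mean b c r‖ₑ} ≤
          2⁻¹ ^ k * gauss n (ball c r) := by
  -- Chosen so that balls of radius at most `ηr` centred in `B(c, r)` are in `𝓑_a`.
  set η := 1 / (1 + a) with hη
  have hη0 : 0 < η := by positivity
  have hη1 : η ≤ 1 := by rw [hη, div_le_one (by positivity)]; linarith
  obtain ⟨D₂, hD₂, h₂⟩ := gauss_ball_le n (A := 2 * a) (by positivity) (K := 2) (by norm_num)
  obtain ⟨E₂, hE₂, hav₂⟩ := av_le_av_of_subset n (A := 2 * a) (by positivity) (K := 2) (by norm_num)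
  obtain ⟨E₀, hE₀, hav₀⟩ :=
    av_le_av_of_subset n (A := 2 * a) (by positivity) (K := 2 / η) (by positivity)
  obtain ⟨D₅, hD₅, h₅⟩ := gauss_ball_five_le n ha.le
  set C₁ := (1 + E₂) * N with hC₁
  -- The first term keeps the initial averages below `Λ`, the second makes the selected balls so
  -- light that their dilates carry at most half the mass of `B(c, r)`, and the third ensures
  -- positivity.
  set Λ := E₀ * C₁ + 2 * D₅ * C₁ * D₂ + 1 with hΛ
  have hΛ0 : 0 < Λ := by positivity
  refine ⟨Λ, hΛ0, fun b hbm hb hN k => ?_⟩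
  induction k with
  | zero =>
    intro c r _
    rw [pow_zero, one_mul]
    exact measure_mono fun x hx => hx.1
  | succ k ih =>
    intro c r hcr
    have hr := hcr.1
    have hcr2 : Admissible (2 * a) c (2 * r) := hcr.mul (by norm_num)
    set b₀ := mean b c r
    set g : E n → ℝ≥0∞ := fun x => ‖b x - b₀‖ₑ with hg
    have hgm : Measurable g := by fun_prop
    have hgi : ∫⁻ x, g x ∂(gauss n) ≠ ∞ := ((hb.sub (integrable_const b₀)).2).ne
    have hbig : av c (2 * r) g ≤ C₁ := by
      refine (av_sub_le hbm c (by positivity) (mean b c (2 * r)) b₀).trans ?_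
      rw [hC₁]
      push_cast
      rw [add_mul, one_mul]
      gcongr
      · exact hN _ _ hcr2
      · rw [enorm_sub_rev]
        refine (enorm_mean_sub_le hb c hr _).trans <|
          (hav₂ c c (2 * r) r hr (ball_subset_ball (by linarith)) hcr2.2 le_rfl _).trans ?_
        gcongr
        exact hN _ _ hcr2
    -- The ratio `1 / 5` matches the Vitali dilation: the dilate of a stopped ball is the preceding
    -- ball, which is admissible and has average at most `Λ`.
    set s : ℕ → ℝ := fun j => η * r * (1 / 5) ^ j with hs
    have hs0 : ∀ j, 0 < s j := fun j => by positivity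
    have hsr : ∀ j, s j ≤ η * r := fun j =>
      mul_le_of_le_one_right (by positivity) (pow_le_one₀ (by norm_num) (by norm_num))
    have hs5 : ∀ j, 5 * s (j + 1) = s j := fun j => by simp only [hs, pow_succ]; ring
    have adm : ∀ x ∈ ball c r, ∀ j, Admissible a x (s j) := fun x hx j => by
      refine ⟨hs0 j, (hsr j).trans ?_⟩
      have := m_le_of_dist_le ha.le (hx.le.trans hcr.2)
      calc η * r ≤ η * (a * ((1 + a) * m x)) := by
            gcongr; exact hcr.2.trans (by gcongr)
        _ = a * m x := by rw [hη]; field_simp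
    set t := {p : E n × ℝ | p.1 ∈ ball c r ∧ Admissible a p.1 p.2 ∧ Admissible a p.1 (5 * p.2) ∧
      p.2 ≤ r ∧ Λ < av p.1 p.2 g ∧ av p.1 (5 * p.2) g ≤ Λ} with ht
    -- Stopping time: take the first radius whose average exceeds `Λ`. It exists at almost every
    -- such point by differentiation, and it is not the initial one.
    have hsel : ∀ᵐ x ∂(gauss n), x ∈ ball c r → Λ < g x → ∃ p ∈ t, p.1 = x := by
      filter_upwards [ae_tendsto_av hgm hgi] with x hx hxB hgx
      have hs_lim : Tendsto s atTop (𝓝[>] 0) := by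
        refine tendsto_nhdsWithin_iff.2 ⟨?_, Eventually.of_forall fun j => hs0 j⟩
        have := (tendsto_pow_atTop_nhds_zero_of_lt_one (r := (1 / 5 : ℝ)) (by norm_num)
          (by norm_num)).const_mul (η * r)
        rwa [mul_zero] at this
      have hex : ∃ j, (Λ : ℝ≥0∞) < av x (s j) g :=
        ((hx.comp hs_lim).eventually (lt_mem_nhds hgx)).exists
      classical
      set j := Nat.find hex with hj
      have hj1 : Λ < av x (s j) g := Nat.find_spec hex
      have hj0 : j ≠ 0 := by
        intro h0
        rw [h0] at hj1
        refine absurd hj1 (not_lt.2 ?_)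
        have e0 : s 0 = η * r := by simp [hs]
        refine (hav₀ c x (2 * r) (s 0) (hs0 0) (ball_subset_ball' ?_) hcr2.2 ?_ g).trans ?_
        · rw [e0]
          have : dist x c < r := hxB
          nlinarith
        · rw [e0]; field_simp; exact le_rfl
        · calc (E₀ : ℝ≥0∞) * av c (2 * r) g ≤ E₀ * C₁ := by gcongr
            _ ≤ Λ := by
              rw [hΛ]; norm_cast
              rw [add_assoc]; exact le_self_add
      obtain ⟨i, hi⟩ := Nat.exists_eq_succ_of_ne_zero hj0
      refine ⟨(x, s j), ⟨hxB, adm x hxB j, ?_, (hsr j).trans (by nlinarith), hj1, ?_⟩, rfl⟩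
      · rw [hi, hs5]; exact adm x hxB i
      · rw [hi, hs5]; exact not_lt.1 (Nat.find_min hex (by omega))
    obtain ⟨u, hut, huc, hud, hcov⟩ := exists_countable_vitali t r
      (fun p hp => ⟨hp.2.1.1, hp.2.2.2.1⟩)
    have hmass : 2 * D₅ * ∑' p : u, gauss n (ball p.1.1 p.1.2) ≤ gauss n (ball c r) := by
      have h1 : Λ * ∑' p : u, gauss n (ball p.1.1 p.1.2) ≤ C₁ * (D₂ * gauss n (ball c r)) := by
        calc Λ * ∑' p : u, gauss n (ball p.1.1 p.1.2)
            = ∑' p : u, gauss n (ball p.1.1 p.1.2) * Λ := by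
              rw [ENNReal.tsum_mul_right, mul_comm]
          _ ≤ ∑' p : u, ∫⁻ x in ball p.1.1 p.1.2, g x ∂(gauss n) := by
              gcongr ∑' p : u, ?_ with p
              rw [← mul_av _ (hut p.2).2.1.1]
              gcongr
              exact (hut p.2).2.2.2.2.1.le
          _ = ∫⁻ x in ⋃ p ∈ u, ball p.1 p.2, g x ∂(gauss n) := by
              rw [lintegral_biUnion huc (fun _ _ => measurableSet_ball) hud]
          _ ≤ ∫⁻ x in ball c (2 * r), g x ∂(gauss n) := by
              refine lintegral_mono_set (iUnion₂_subset fun p hp => ball_subset_ball' ?_)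
              have h1 : dist p.1 c < r := (hut hp).1
              have h2 := (hut hp).2.2.2.1
              linarith
          _ = av c (2 * r) g * gauss n (ball c (2 * r)) := by
              rw [← mul_av c (by positivity) g, mul_comm]
          _ ≤ _ := by
              gcongr
              exact h₂ c c (2 * r) r hr (ball_subset_ball (by linarith)) hcr2.2 le_rfl
      have h2 : Λ * (2 * D₅ * ∑' p : u, gauss n (ball p.1.1 p.1.2)) ≤
          Λ * gauss n (ball c r) := by
        calc Λ * (2 * D₅ * ∑' p : u, gauss n (ball p.1.1 p.1.2))
            = 2 * D₅ * (Λ * ∑' p : u, gauss n (ball p.1.1 p.1.2)) := by ring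
          _ ≤ 2 * D₅ * (C₁ * (D₂ * gauss n (ball c r))) := by gcongr
          _ = (2 * D₅ * C₁ * D₂ : ℝ≥0) * gauss n (ball c r) := by push_cast; ring
          _ ≤ Λ * gauss n (ball c r) := by
              gcongr
              rw [hΛ, add_assoc, add_left_comm]; exact le_self_add
      exact (ENNReal.mul_le_mul_iff_right (by simpa using hΛ0.ne') (by simp)).1 h2
    -- The mean over a dilated selected ball differs from `b₀` by at most `Λ`, so recentring costs
    -- one level and the induction hypothesis applies to each dilate.
    have hsub : ({x ∈ ball c r | (k + 1 : ℕ) * (Λ : ℝ≥0∞) < g x} : Set (E n)) ≤ᵐ[gauss n]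
        ⋃ p ∈ u, {x ∈ ball p.1 (5 * p.2) | k * (Λ : ℝ≥0∞) < ‖b x - mean b p.1 (5 * p.2)‖ₑ} := by
      filter_upwards [hsel] with x hx hxm
      obtain ⟨hxB, hxg⟩ := hxm
      push_cast at hxg
      obtain ⟨p, hp, rfl⟩ := hx hxB (lt_of_le_of_lt (by rw [add_mul, one_mul]; exact le_add_self) hxg)
      obtain ⟨p', hp', hpp'⟩ := hcov p hp
      refine mem_biUnion hp' ⟨hpp' (mem_ball_self hp.2.1.1), ?_⟩
      have h1 : g p.1 ≤ ‖b p.1 - mean b p'.1 (5 * p'.2)‖ₑ + Λ := by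
        simp only [hg]
        rw [← sub_add_sub_cancel (b p.1) (mean b p'.1 (5 * p'.2)) b₀]
        refine (enorm_add_le _ _).trans ?_
        gcongr
        exact (enorm_mean_sub_le hb _ (hut hp').2.2.1.1 _).trans (hut hp').2.2.2.2.2
      rw [add_mul, one_mul] at hxg
      exact lt_of_add_lt_add_right (hxg.trans_le h1)
    calc gauss n {x ∈ ball c r | (k + 1 : ℕ) * (Λ : ℝ≥0∞) < g x}
        ≤ ∑' p : u, gauss n {x ∈ ball p.1.1 (5 * p.1.2) |
            k * (Λ : ℝ≥0∞) < ‖b x - mean b p.1.1 (5 * p.1.2)‖ₑ} :=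
          (measure_mono_ae hsub).trans (measure_biUnion_le _ huc _)
      _ ≤ ∑' p : u, 2⁻¹ ^ k * (D₅ * gauss n (ball p.1.1 p.1.2)) := by
          gcongr ∑' p : u, ?_ with p
          refine (ih _ _ (hut p.2).2.2.1).trans ?_
          gcongr
          exact h₅ _ _ (hut p.2).2.1
      _ = 2⁻¹ ^ (k + 1) * (2 * D₅ * ∑' p : u, gauss n (ball p.1.1 p.1.2)) := by
          rw [ENNReal.tsum_mul_left, ENNReal.tsum_mul_left, pow_succ, ← mul_assoc _ (2 * _),
            mul_assoc _ 2⁻¹, ← mul_assoc 2⁻¹ 2,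
            ENNReal.inv_mul_cancel (by norm_num) (by norm_num), one_mul, mul_assoc]
      _ ≤ _ := by gcongr

theorem rpow_le_one_add_rpow {σ τ : ℝ} (hσ : 0 ≤ σ) (hτ : σ ≤ τ) (h : ℝ≥0∞) :
    h ^ σ ≤ 1 + h ^ τ := by
  rcases le_total h 1 with h1 | h1
  · exact (ENNReal.rpow_le_one h1 hσ).trans le_self_add
  · exact (ENNReal.rpow_le_rpow_of_exponent_le h1 hτ).trans le_add_self

/-- All moments of the oscillation are bounded on admissible balls. -/
theorem lintegral_osc_rpow_le (n : ℕ) {a : ℝ} (ha : 0 < a) (N : ℝ≥0) {σ : ℝ} (hσ : 0 ≤ σ) :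
    ∃ C : ℝ≥0, 0 < C ∧ ∀ b : E n → 𝕜, Measurable b → Integrable b (gauss n) →
      (∀ c r, Admissible (2 * a) c r → meanOsc b c r ≤ N) →
      ∀ c r, Admissible a c r →
        ∫⁻ x in ball c r, ‖b x - mean b c r‖ₑ ^ σ ∂(gauss n) ≤ C * gauss n (ball c r) := by
  obtain ⟨Λ, hΛ, hJN⟩ := john_nirenberg (𝕜 := 𝕜) n ha N
  -- An integer exponent turns the layer sum into a polynomial times `2^(-k)`. It is kept positive
  -- so that points of zero oscillation contribute nothing.
  obtain ⟨M, hM⟩ := exists_nat_ge (max σ 1)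
  have hM1 : M ≠ 0 := by
    rintro rfl
    have := (le_max_right σ 1).trans hM
    norm_num at this
  set S : ℝ≥0∞ := ∑' k : ℕ, ((k + 1) * Λ : ℝ≥0∞) ^ M * 2⁻¹ ^ k with hS
  have hS' : S ≠ ∞ := by
    have hsum : Summable fun k : ℕ => ((k + 1 : ℝ≥0) * Λ) ^ M * 2⁻¹ ^ k := by
      rw [← NNReal.summable_coe]
      have := (summable_nat_add_iff 1).2 (summable_pow_mul_geometric_of_norm_lt_one (R := ℝ) M
        (r := 2⁻¹) (by norm_num))
      refine (this.mul_left (2 * (Λ : ℝ) ^ M)).congr fun k => ?_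
      push_cast
      rw [mul_pow, pow_succ]
      ring
    have := ENNReal.tsum_coe_ne_top_iff_summable.2 hsum
    convert this using 3 with k
    push_cast
    norm_num
  refine ⟨1 + S.toNNReal, by positivity, fun b hbm hb hN c r hcr => ?_⟩
  set g : E n → ℝ≥0∞ := fun x => ‖b x - mean b c r‖ₑ with hg
  have hgm : Measurable g := by fun_prop
  have hpt : ∀ x, g x ^ M ≤
      ∑' k : ℕ, {y | k * (Λ : ℝ≥0∞) < g y}.indicator (fun _ => ((k + 1) * Λ : ℝ≥0∞) ^ M) x := by
    intro x
    rcases eq_or_ne (g x) 0 with h0 | h0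
    · simp [h0, hM1]
    have hex : ∃ k : ℕ, g x ≤ (k + 1) * Λ := by
      obtain ⟨k, hk⟩ := ENNReal.exists_nat_mul_gt (a := (Λ : ℝ≥0∞)) (b := g x)
        (by simpa using hΛ.ne') (by simp [hg])
      exact ⟨k, hk.le.trans (by gcongr; exact le_self_add)⟩
    classical
    have hk1 := Nat.find_spec hex
    have hk2 : Nat.find hex * (Λ : ℝ≥0∞) < g x := by
      rcases Nat.eq_zero_or_eq_succ_pred (Nat.find hex) with h | h
      · rw [h]; simpa using pos_iff_ne_zero.2 h0
      · rw [h]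
        have := Nat.find_min hex (m := (Nat.find hex).pred) (by omega)
        push_cast
        exact not_le.1 this
    refine le_trans ?_ (ENNReal.le_tsum (Nat.find hex))
    rw [indicator_of_mem (by exact hk2)]
    gcongr
  have hint : ∫⁻ x in ball c r, g x ^ M ∂(gauss n) ≤ S * gauss n (ball c r) := by
    have hms : ∀ k : ℕ, MeasurableSet {y | k * (Λ : ℝ≥0∞) < g y} := fun k =>
      measurableSet_lt measurable_const hgm
    calc ∫⁻ x in ball c r, g x ^ M ∂(gauss n)
        ≤ ∫⁻ x in ball c r, ∑' k : ℕ, {y | k * (Λ : ℝ≥0∞) < g y}.indicator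
            (fun _ => ((k + 1) * Λ : ℝ≥0∞) ^ M) x ∂(gauss n) := lintegral_mono hpt
      _ = ∑' k : ℕ, ((k + 1) * Λ : ℝ≥0∞) ^ M *
            gauss n {x ∈ ball c r | k * (Λ : ℝ≥0∞) < g x} := by
          rw [lintegral_tsum fun k => (measurable_const.indicator (hms k)).aemeasurable]
          refine tsum_congr fun k => ?_
          rw [lintegral_indicator_const (hms k), Measure.restrict_apply (hms k), inter_comm]
          rfl
      _ ≤ ∑' k : ℕ, ((k + 1) * Λ : ℝ≥0∞) ^ M * (2⁻¹ ^ k * gauss n (ball c r)) := by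
          gcongr ∑' k : ℕ, _ * ?_ with k
          exact hJN b hbm hb hN k c r hcr
      _ = S * gauss n (ball c r) := by
          rw [hS, ← ENNReal.tsum_mul_right]
          simp_rw [mul_assoc]
  calc ∫⁻ x in ball c r, g x ^ σ ∂(gauss n)
      ≤ ∫⁻ x in ball c r, (1 + g x ^ M) ∂(gauss n) :=
        lintegral_mono fun x => by
          simpa using rpow_le_one_add_rpow hσ ((le_max_left _ _).trans hM) (g x)
    _ ≤ gauss n (ball c r) + S * gauss n (ball c r) := by
        rw [lintegral_add_left measurable_const, setLIntegral_one]
        gcongr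
    _ = _ := by
        push_cast
        rw [ENNReal.coe_toNNReal hS', add_mul, one_mul]

/-! ### Algebra and measurability of the maximal commutator -/

theorem maxComm_congr_right {a β : ℝ} {b f f' : E n → 𝕜} (h : f =ᵐ[gauss n] f') :
    maxComm a β b f = maxComm a β b f' := by
  ext x
  unfold maxComm
  refine iSup_congr fun c => iSup_congr fun r => iSup_congr fun _ => iSup_congr fun _ => ?_
  congr 1
  refine lintegral_congr_ae (ae_restrict_of_ae ?_)
  filter_upwards [h] with y hy
  rw [hy]

theorem maxComm_congr_left {a β : ℝ} {b b' f : E n → 𝕜} (h : b =ᵐ[gauss n] b') :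
    maxComm a β b f =ᵐ[gauss n] maxComm a β b' f := by
  filter_upwards [h] with x hx
  unfold maxComm
  refine iSup_congr fun c => iSup_congr fun r => iSup_congr fun _ => iSup_congr fun _ => ?_
  congr 1
  refine lintegral_congr_ae (ae_restrict_of_ae ?_)
  filter_upwards [h] with y hy
  rw [hy, hx]

theorem meanOsc_congr {b b' : E n → 𝕜} (h : b =ᵐ[gauss n] b') (c : E n) (r : ℝ) :
    meanOsc b c r = meanOsc b' c r := by
  have : mean b c r = mean b' c r := by
    unfold mean
    exact average_congr (ae_restrict_of_ae h)
  rw [meanOsc_eq_av, meanOsc_eq_av, this]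
  refine av_congr_ae ?_
  filter_upwards [h] with y hy
  rw [hy]

theorem starNorm_congr {b b' : E n → 𝕜} (h : b =ᵐ[gauss n] b') : starNorm b = starNorm b' := by
  unfold starNorm
  simp_rw [meanOsc_congr h]

theorem meanOsc_le_starNorm (b : E n → 𝕜) {c : E n} {r : ℝ} (h : Admissible 1 c r) :
    meanOsc b c r ≤ starNorm b :=
  le_iSup_of_le c <| le_iSup_of_le r <| le_iSup_of_le h le_rfl

theorem starNorm_smul (z : 𝕜) (b : E n → 𝕜) : starNorm (z • b) = ‖z‖ₑ * starNorm b := by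
  unfold starNorm
  simp_rw [ENNReal.mul_iSup]
  refine iSup_congr fun c => iSup_congr fun r => iSup_congr fun _ => ?_
  have : mean (z • b) c r = z * mean b c r := by
    simp only [mean, Pi.smul_apply, smul_eq_mul, setAverage_eq, integral_const_mul]
    rw [mul_smul_comm]
  rw [meanOsc_eq_av, meanOsc_eq_av, this]
  unfold av
  rw [mul_left_comm, ← lintegral_const_mul' _ _ enorm_ne_top]
  simp only [Pi.smul_apply, smul_eq_mul, ← mul_sub, enorm_mul]

theorem maxComm_smul_left (a β : ℝ) (z : 𝕜) (b f : E n → 𝕜) (x : E n) :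
    maxComm a β (z • b) f x = ‖z‖ₑ * maxComm a β b f x := by
  unfold maxComm
  simp_rw [ENNReal.mul_iSup]
  refine iSup_congr fun c => iSup_congr fun r => iSup_congr fun _ => iSup_congr fun _ => ?_
  rw [mul_left_comm, ← lintegral_const_mul' _ _ enorm_ne_top]
  simp only [Pi.smul_apply, smul_eq_mul, ← mul_sub, enorm_mul, mul_assoc]

theorem maxComm_smul_right (a β : ℝ) (z : 𝕜) (b f : E n → 𝕜) (x : E n) :
    maxComm a β b (z • f) x = ‖z‖ₑ * maxComm a β b f x := by
  unfold maxComm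
  simp_rw [ENNReal.mul_iSup]
  refine iSup_congr fun c => iSup_congr fun r => iSup_congr fun _ => iSup_congr fun _ => ?_
  rw [mul_left_comm, ← lintegral_const_mul' _ _ enorm_ne_top]
  simp only [Pi.smul_apply, smul_eq_mul, enorm_mul, mul_left_comm]

theorem maxComm_add_le (a β : ℝ) {b f g : E n → 𝕜} (hb : AEStronglyMeasurable b (gauss n))
    (hf : AEStronglyMeasurable f (gauss n)) (x : E n) :
    maxComm a β b (f + g) x ≤ maxComm a β b f x + maxComm a β b g x := by
  refine iSup_le fun c => iSup_le fun r => iSup_le fun h => iSup_le fun hx => ?_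
  have hm : AEMeasurable (fun y => ‖b x - b y‖ₑ * ‖f y‖ₑ) ((gauss n).restrict (ball c r)) :=
    ((aestronglyMeasurable_const.sub hb).enorm.mul hf.enorm).restrict
  calc _ ≤ (gauss n (ball c r) ^ (1 - β))⁻¹ * ∫⁻ y in ball c r,
        (‖b x - b y‖ₑ * ‖f y‖ₑ + ‖b x - b y‖ₑ * ‖g y‖ₑ) ∂(gauss n) := by
        gcongr with y
        rw [← mul_add]
        gcongr
        exact enorm_add_le _ _
    _ = _ := by rw [lintegral_add_left' hm, mul_add]
    _ ≤ _ := by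
        gcongr
        · exact le_iSup_of_le c <| le_iSup_of_le r <| le_iSup_of_le h <| le_iSup_of_le hx le_rfl
        · exact le_iSup_of_le c <| le_iSup_of_le r <| le_iSup_of_le h <| le_iSup_of_le hx le_rfl

theorem continuous_m : Continuous (m : E n → ℝ) := by
  unfold m
  exact (continuous_const.max continuous_norm).inv₀ fun x => by positivity

/-- An admissible ball is approximated from inside by admissible balls with centre in a given
dense sequence and rational radius. -/
theorem exists_admissible_denseSeq {a : ℝ} {c : E n} {r r' : ℝ} (h : Admissible a c r)
    (h0 : 0 < r') (hr : r' < r) :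
    ∃ (i : ℕ) (ρ : ℚ), Admissible a (TopologicalSpace.denseSeq (E n) i) ρ ∧
      ball c r' ⊆ ball (TopologicalSpace.denseSeq (E n) i) ρ ∧
      ball (TopologicalSpace.denseSeq (E n) i) ρ ⊆ ball c r := by
  -- The centre moves by less than `δ` and `ρ` lies between `r' + δ` and `r' + 2δ`, which gives both
  -- inclusions. Admissibility survives because `ρ < r ≤ a m(c)` is strict and `m` is continuous.
  set δ := (r - r') / 4 with hδ
  have hδ0 : 0 < δ := by rw [hδ]; linarith
  obtain ⟨ρ, h1, h2⟩ := exists_rat_btwn (show r' + δ < r' + 2 * δ by linarith)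
  have hρ : (ρ : ℝ) < r := by linarith
  have hopen : IsOpen (ball c δ ∩ {y | (ρ : ℝ) < a * m y}) :=
    isOpen_ball.inter (isOpen_lt continuous_const (continuous_const.mul continuous_m))
  obtain ⟨i, hi1, hi2⟩ := (TopologicalSpace.denseRange_denseSeq (E n)).exists_mem_open hopen
    ⟨c, mem_ball_self hδ0, hρ.trans_le h.2⟩
  have hd := mem_ball.1 hi1
  refine ⟨i, ρ, ⟨by linarith, le_of_lt hi2⟩, ball_subset_ball' ?_, ball_subset_ball' ?_⟩
  · rw [dist_comm]; linarith
  · linarith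

theorem exists_lt_setLIntegral_ball {F : E n → ℝ≥0∞} {c : E n} {r : ℝ} {k t : ℝ≥0∞}
    (h : t < k * ∫⁻ y in ball c r, F y ∂(gauss n)) :
    ∃ r' < r, t < k * ∫⁻ y in ball c r', F y ∂(gauss n) := by
  have hU : ball c r = ⋃ j : ℕ, ball c (r - 1 / (j + 1)) := by
    ext y
    simp only [mem_ball, mem_iUnion]
    constructor
    · intro hy
      obtain ⟨j, hj⟩ := exists_nat_one_div_lt (sub_pos.2 hy)
      exact ⟨j, by linarith⟩
    · rintro ⟨j, hj⟩
      have : (0 : ℝ) < 1 / (j + 1) := by positivity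
      linarith
  have hmono : Monotone fun j : ℕ => ball c (r - 1 / ((j : ℝ) + 1)) := fun i j hij =>
    ball_subset_ball (sub_le_sub_left (Nat.one_div_le_one_div hij) r)
  rw [hU, setLIntegral_iUnion_of_directed _ hmono.directed_le, ENNReal.mul_iSup, lt_iSup_iff] at h
  obtain ⟨j, hj⟩ := h
  have : (0 : ℝ) < 1 / (j + 1) := by positivity
  exact ⟨_, by linarith, hj⟩

/-- A countable supremum is needed for measurability: as `b x` occurs inside, the superlevel sets
need not be open, unlike those of `maxFun`. Shrinking a ball slightly loses little of the integral,
and the negative power of its measure can only grow. -/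
theorem maxComm_eq_iSup_denseSeq {a β : ℝ} (hβ : β ≤ 1) (b f : E n → 𝕜) (x : E n) :
    maxComm a β b f x = ⨆ (i : ℕ) (ρ : ℚ)
      (_ : Admissible a (TopologicalSpace.denseSeq (E n) i) ρ)
      (_ : x ∈ ball (TopologicalSpace.denseSeq (E n) i) ρ),
      (gauss n (ball (TopologicalSpace.denseSeq (E n) i) ρ) ^ (1 - β))⁻¹ *
        ∫⁻ y in ball (TopologicalSpace.denseSeq (E n) i) ρ, ‖b x - b y‖ₑ * ‖f y‖ₑ ∂(gauss n) := by
  refine le_antisymm ?_ ?_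
  · refine iSup_le fun c => iSup_le fun r => iSup_le fun h => iSup_le fun hx => ?_
    refine le_of_forall_lt fun t ht => ?_
    obtain ⟨r₁, hr₁, ht₁⟩ := exists_lt_setLIntegral_ball ht
    set r' := max r₁ ((dist x c + r) / 2) with hr'
    have hx' : dist x c < r := hx
    have hxr' : dist x c < r' := lt_max_of_lt_right (by linarith)
    obtain ⟨i, ρ, hadm, hs1, hs2⟩ := exists_admissible_denseSeq h
      (r' := r') (dist_nonneg.trans_lt hxr') (max_lt hr₁ (by linarith))
    refine ht₁.trans_le ?_
    refine le_iSup_of_le i <| le_iSup_of_le ρ <| le_iSup_of_le hadm <|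
      le_iSup_of_le (hs1 hxr') ?_
    have hs3 : ball c r₁ ⊆ ball (TopologicalSpace.denseSeq (E n) i) ρ :=
      (ball_subset_ball (le_max_left _ _)).trans hs1
    have : 0 ≤ 1 - β := by linarith
    gcongr
  · exact iSup_le fun i => iSup_le fun ρ => iSup_le fun h => iSup_le fun hx =>
      le_iSup_of_le _ <| le_iSup_of_le _ <| le_iSup_of_le h <| le_iSup_of_le hx le_rfl

theorem measurable_maxComm {a β : ℝ} (hβ : β ≤ 1) {b f : E n → 𝕜} (hb : Measurable b)
    (hf : Measurable f) : Measurable (maxComm a β b f) := by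
  have : maxComm a β b f = _ := funext fun x => maxComm_eq_iSup_denseSeq hβ b f x
  rw [this]
  refine Measurable.iSup fun i => Measurable.iSup fun ρ => Measurable.iSup fun _ => ?_
  set B := ball (TopologicalSpace.denseSeq (E n) i) (ρ : ℝ)
  have hF : Measurable fun x => (gauss n B ^ (1 - β))⁻¹ *
      ∫⁻ y in B, ‖b x - b y‖ₑ * ‖f y‖ₑ ∂(gauss n) := by
    refine Measurable.const_mul (Measurable.lintegral_prod_right' (f := fun z : E n × E n =>
      ‖b z.1 - b z.2‖ₑ * ‖f z.2‖ₑ) ?_) _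
    exact ((hb.comp measurable_fst).sub (hb.comp measurable_snd)).enorm.mul
      (hf.comp measurable_snd).enorm
  convert hF.indicator (measurableSet_ball : MeasurableSet B) using 1
  ext x
  by_cases hx : x ∈ B
  · exact (iSup_pos hx).trans (by rw [indicator_of_mem (by exact hx)])
  · exact (iSup_neg hx).trans (by rw [indicator_of_notMem (by exact hx)]; rfl)

theorem aemeasurable_maxComm {a β : ℝ} (hβ : β ≤ 1) {b f : E n → 𝕜}
    (hb : AEStronglyMeasurable b (gauss n)) (hf : AEStronglyMeasurable f (gauss n)) :
    AEMeasurable (maxComm a β b f) (gauss n) := by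
  refine ⟨maxComm a β (hb.mk b) (hf.mk f), measurable_maxComm hβ hb.stronglyMeasurable_mk.measurable
    hf.stronglyMeasurable_mk.measurable, ?_⟩
  rw [maxComm_congr_right hf.ae_eq_mk]
  exact maxComm_congr_left hb.ae_eq_mk

/-! ### Strong type bound for the maximal commutator -/

/-- The oscillation of `b` around its mean over `B(c, r)`, together with the maximal function of
its `s`-th power on that ball. -/
def oscMax (A s : ℝ) (b : E n → 𝕜) (c : E n) (r : ℝ) (x : E n) : ℝ≥0∞ :=
  ‖b x - mean b c r‖ₑ +
    maxFun A (indicator (ball c r) fun y => ‖b y - mean b c r‖ₑ ^ s) x ^ (1 / s)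

theorem measurable_oscMax (A s : ℝ) {b : E n → 𝕜} (hb : Measurable b) (c : E n) (r : ℝ) :
    Measurable (oscMax A s b c r) :=
  (hb.sub measurable_const).enorm.add ((measurable_maxFun _ _).pow_const _)

theorem lintegral_oscMax_rpow_le (n : ℕ) {a A : ℝ} (ha : 0 < a) (hA : 0 ≤ A) (N : ℝ≥0)
    {s q : ℝ} (hs : 1 ≤ s) (hq : 1 ≤ q) :
    ∃ C : ℝ≥0, 0 < C ∧ ∀ b : E n → 𝕜, Measurable b → Integrable b (gauss n) →
      (∀ c r, Admissible (2 * a) c r → meanOsc b c r ≤ N) →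
      ∀ c r, Admissible a c r →
        ∫⁻ x in ball c r, oscMax A s b c r x ^ q ∂(gauss n) ≤ C * gauss n (ball c r) := by
  have hs0 : 0 < s := by linarith
  have hq0 : 0 < q := by linarith
  obtain ⟨C₁, hC₁, h₁⟩ := lintegral_osc_rpow_le (𝕜 := 𝕜) n ha N (σ := q) (by linarith)
  obtain ⟨C₂, hC₂, h₂⟩ := lintegral_osc_rpow_le (𝕜 := 𝕜) n ha N (σ := s * (q / s + 1))
    (by positivity)
  -- The natural exponent `q / s` may be at most `1`; raising it by one allows the strong type
  -- inequality and costs only the measure of the ball.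
  obtain ⟨D, hD, hM⟩ := maxFun_strong n hA (r := q / s + 1) (by linarith [div_pos hq0 hs0])
  refine ⟨2 ^ (q - 1) * (C₁ + (1 + D * C₂)), by positivity, fun b hbm hb hN c r hcr => ?_⟩
  set g : E n → ℝ≥0∞ := fun y => ‖b y - mean b c r‖ₑ with hg
  have hgm : Measurable g := by fun_prop
  set w : E n → ℝ≥0∞ := indicator (ball c r) fun y => g y ^ s with hw
  have hwm : Measurable w := (hgm.pow_const s).indicator measurableSet_ball
  have hmax : ∫⁻ x in ball c r, (maxFun A w x ^ (1 / s)) ^ q ∂(gauss n) ≤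
      (1 + D * C₂) * gauss n (ball c r) := by
    calc ∫⁻ x in ball c r, (maxFun A w x ^ (1 / s)) ^ q ∂(gauss n)
        ≤ ∫⁻ x in ball c r, (1 + maxFun A w x ^ (q / s + 1)) ∂(gauss n) := by
          refine lintegral_mono fun x => ?_
          dsimp only
          rw [← ENNReal.rpow_mul, show 1 / s * q = q / s by ring]
          exact rpow_le_one_add_rpow (by positivity) (by linarith) _
      _ ≤ gauss n (ball c r) + ∫⁻ x, maxFun A w x ^ (q / s + 1) ∂(gauss n) := by
          rw [lintegral_add_left measurable_const, setLIntegral_one]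
          gcongr
          exact Measure.restrict_le_self
      _ ≤ gauss n (ball c r) + D * ∫⁻ x, w x ^ (q / s + 1) ∂(gauss n) := by
          gcongr
          exact hM w hwm
      _ = gauss n (ball c r) + D * ∫⁻ x in ball c r, g x ^ (s * (q / s + 1)) ∂(gauss n) := by
          rw [← lintegral_indicator measurableSet_ball]
          congr 2
          refine lintegral_congr fun x => ?_
          by_cases hx : x ∈ ball c r
          · simp only [hw, indicator_of_mem hx, ENNReal.rpow_mul]
          · simp only [hw, indicator_of_notMem hx]
            exact ENNReal.zero_rpow_of_pos (by positivity)
      _ ≤ gauss n (ball c r) + D * (C₂ * gauss n (ball c r)) := by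
          gcongr
          exact h₂ b hbm hb hN c r hcr
      _ = _ := by ring
  calc ∫⁻ x in ball c r, oscMax A s b c r x ^ q ∂(gauss n)
      ≤ ∫⁻ x in ball c r, 2 ^ (q - 1) * (g x ^ q + (maxFun A w x ^ (1 / s)) ^ q) ∂(gauss n) :=
        lintegral_mono fun x => ENNReal.rpow_add_le_mul_rpow_add_rpow _ _ hq
    _ = 2 ^ (q - 1) * (∫⁻ x in ball c r, g x ^ q ∂(gauss n) +
          ∫⁻ x in ball c r, (maxFun A w x ^ (1 / s)) ^ q ∂(gauss n)) := by
        rw [lintegral_const_mul' _ _ (ENNReal.rpow_ne_top_of_nonneg (by linarith) (by norm_num)),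
          lintegral_add_left (hgm.pow_const q)]
    _ ≤ 2 ^ (q - 1) * (C₁ * gauss n (ball c r) + (1 + D * C₂) * gauss n (ball c r)) := by
        gcongr
        exact h₁ b hbm hb hN c r hcr
    _ = _ := by
        push_cast
        rw [ENNReal.coe_rpow_of_nonneg _ (by linarith)]
        push_cast
        ring

/-- The fractional average `γ(B)^β (γ(B)⁻¹ ∫_B u^s dγ)^{1/s}`. -/
def fracAv (β s : ℝ) (u : E n → ℝ≥0∞) (c : E n) (r : ℝ) : ℝ≥0∞ :=
  gauss n (ball c r) ^ β * av c r (fun x => u x ^ s) ^ (1 / s)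

theorem av_rpow_le {s p : ℝ} (hs : 1 ≤ s) (hsp : s ≤ p) {u : E n → ℝ≥0∞} (hu : Measurable u)
    (c : E n) {r : ℝ} (hr : 0 < r) :
    av c r (fun x => u x ^ s) ^ (1 / s) ≤
      ((gauss n (ball c r))⁻¹ * ∫⁻ x, u x ^ p ∂(gauss n)) ^ (1 / p) := by
  have hs0 : 0 < s := by linarith
  have hp0 : 0 < p := by linarith
  have h1 := av_le_rpow_av c hr (s := p / s) ((one_le_div hs0).2 hsp) (hu.pow_const s).aemeasurable
  simp_rw [← ENNReal.rpow_mul, mul_div_cancel₀ p hs0.ne'] at h1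
  calc av c r (fun x => u x ^ s) ^ (1 / s)
      ≤ (av c r (fun x => u x ^ p) ^ (1 / (p / s))) ^ (1 / s) := by gcongr
    _ = av c r (fun x => u x ^ p) ^ (1 / p) := by
        rw [← ENNReal.rpow_mul]; congr 1; field_simp
    _ ≤ _ := by
        unfold av
        gcongr
        exact Measure.restrict_le_self

theorem fracAv_ne_top {β s p : ℝ} (hβ : 0 ≤ β) (hs : 1 ≤ s) (hsp : s ≤ p) {u : E n → ℝ≥0∞}
    (hu : Measurable u) (hI : ∫⁻ x, u x ^ p ∂(gauss n) ≠ ∞) (c : E n) {r : ℝ} (hr : 0 < r) :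
    fracAv β s u c r ≠ ∞ := by
  refine ENNReal.mul_ne_top (ENNReal.rpow_ne_top_of_nonneg hβ (gauss_ball_ne_top c r)) ?_
  refine ne_top_of_le_ne_top (ENNReal.rpow_ne_top_of_nonneg ?_ ?_) (av_rpow_le hs hsp hu c hr)
  · have : 0 < p := by linarith
    positivity
  · exact ENNReal.mul_ne_top (ENNReal.inv_ne_top.2 (gauss_ball_pos c hr).ne') hI

/-- Hedberg's inequality. -/
theorem fracAv_rpow_le {β s p q : ℝ} (hs : 1 ≤ s) (hsp : s ≤ p) (hpq : p ≤ q)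
    (hβ : 1 / q = 1 / p - β) {u : E n → ℝ≥0∞} (hu : Measurable u) (c : E n) {r : ℝ} (hr : 0 < r) :
    fracAv β s u c r ^ q ≤
      av c r (fun x => u x ^ s) ^ (p / s) * (∫⁻ x, u x ^ p ∂(gauss n)) ^ (q / p - 1) := by
  have hs0 : 0 < s := by linarith
  have hp0 : 0 < p := by linarith
  have hq0 : 0 < q := by linarith
  set I := ∫⁻ x, u x ^ p ∂(gauss n)
  set X := av c r (fun x => u x ^ s) with hX
  set G := gauss n (ball c r) with hG
  have hG0 : G ≠ 0 := (gauss_ball_pos c hr).ne'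
  have hGt : G ≠ ∞ := gauss_ball_ne_top c r
  have hβq : β * q = q / p - 1 := by
    have : β = 1 / p - 1 / q := by linarith
    rw [this]; field_simp
  have hnn : 0 ≤ q / p - 1 := by rw [sub_nonneg, one_le_div hp0]; exact hpq
  -- Of the `q` powers, `p` are kept for the maximal function and `q - p` are traded for the global
  -- norm; the resulting power of `G⁻¹` cancels `G ^ (β * q)`.
  have hX1 : (X ^ (1 / s)) ^ (q - p) ≤ (G⁻¹ * I) ^ (q / p - 1) := by
    calc (X ^ (1 / s)) ^ (q - p) ≤ ((G⁻¹ * I) ^ (1 / p)) ^ (q - p) :=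
          ENNReal.rpow_le_rpow (av_rpow_le hs hsp hu c hr) (by linarith)
      _ = _ := by rw [← ENNReal.rpow_mul]; congr 1; field_simp
  calc fracAv β s u c r ^ q = G ^ (q / p - 1) * (X ^ (1 / s)) ^ q := by
        rw [fracAv, ENNReal.mul_rpow_of_nonneg _ _ hq0.le, ← ENNReal.rpow_mul, hβq]
    _ = G ^ (q / p - 1) * ((X ^ (1 / s)) ^ p * (X ^ (1 / s)) ^ (q - p)) := by
        rw [← ENNReal.rpow_add_of_nonneg _ _ hp0.le (by linarith)]; congr 2; ring
    _ ≤ G ^ (q / p - 1) * (X ^ (p / s) * (G⁻¹ * I) ^ (q / p - 1)) := by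
        gcongr
        rw [← ENNReal.rpow_mul]
        exact le_of_eq (by congr 1; ring)
    _ = (G * G⁻¹) ^ (q / p - 1) * (X ^ (p / s) * I ^ (q / p - 1)) := by
        rw [ENNReal.mul_rpow_of_nonneg _ _ hnn, ENNReal.mul_rpow_of_nonneg _ _ hnn]; ring
    _ = _ := by rw [ENNReal.mul_inv_cancel hG0 hGt, ENNReal.one_rpow, one_mul]

/-- The commutator average over one ball is bounded by the fractional average of `f` times the
oscillation of `b` around any constant. -/
theorem commAv_le {β s s' : ℝ} (hs : s'.HolderConjugate s) (hs1 : 1 ≤ s) {b f : E n → 𝕜}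
    (hb : Measurable b) (hf : Measurable f) (x c : E n) {r : ℝ} (hr : 0 < r) (κ : 𝕜) :
    (gauss n (ball c r) ^ (1 - β))⁻¹ * ∫⁻ y in ball c r, ‖b x - b y‖ₑ * ‖f y‖ₑ ∂(gauss n) ≤
      fracAv β s (fun y => ‖f y‖ₑ) c r *
        (‖b x - κ‖ₑ + av c r (fun y => ‖b y - κ‖ₑ ^ s') ^ (1 / s')) := by
  set G := gauss n (ball c r) with hG
  have hG0 : G ≠ 0 := (gauss_ball_pos c hr).ne'
  have hGt : G ≠ ∞ := gauss_ball_ne_top c r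
  have hfm : Measurable fun y => ‖f y‖ₑ := hf.enorm
  have hgm : Measurable fun y => ‖b y - κ‖ₑ := by fun_prop
  have hGβ : (G ^ (1 - β))⁻¹ * G = G ^ β := by
    nth_rw 2 [← ENNReal.rpow_one G]
    rw [← ENNReal.rpow_neg, ← ENNReal.rpow_add _ _ hG0 hGt]
    congr 1; ring
  rw [← mul_av c hr, ← hG, ← mul_assoc, hGβ, fracAv, ← hG, mul_assoc]
  gcongr
  calc av c r (fun y => ‖b x - b y‖ₑ * ‖f y‖ₑ)
      ≤ av c r (fun y => ‖b x - κ‖ₑ * ‖f y‖ₑ + ‖b y - κ‖ₑ * ‖f y‖ₑ) := by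
        refine av_mono_on fun y _ => ?_
        rw [← add_mul]
        gcongr
        rw [← sub_sub_sub_cancel_right _ _ κ]
        exact enorm_sub_le
    _ = ‖b x - κ‖ₑ * av c r (fun y => ‖f y‖ₑ) + av c r (fun y => ‖b y - κ‖ₑ * ‖f y‖ₑ) := by
        rw [av_add (hfm.const_mul _)]
        congr 1
        unfold av
        rw [lintegral_const_mul _ hfm, mul_left_comm]
    _ ≤ ‖b x - κ‖ₑ * av c r (fun y => ‖f y‖ₑ ^ s) ^ (1 / s) +
          av c r (fun y => ‖b y - κ‖ₑ ^ s') ^ (1 / s') * av c r (fun y => ‖f y‖ₑ ^ s) ^ (1 / s) := by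
        gcongr
        · exact av_le_rpow_av c hr hs1 hfm.aemeasurable
        · exact av_mul_le c r hs hgm.aemeasurable hfm.aemeasurable
    _ = _ := by ring

/-- The strong type bound for the maximal commutator, normalised to `‖b‖_* ≤ 1`. -/
theorem lintegral_maxComm_rpow_le (n : ℕ) {a β p q : ℝ} (ha : 0 < a) (hβ0 : 0 < β)
    (hp : 1 < p) (hpq : p < q) (hpqβ : 1 / q = 1 / p - β) :
    ∃ C : ℝ≥0, 0 < C ∧ ∀ b : E n → 𝕜, Measurable b → Integrable b (gauss n) → starNorm b ≤ 1 →
      ∀ f : E n → 𝕜, Measurable f → ∫⁻ x, ‖f x‖ₑ ^ p ∂(gauss n) ≠ ∞ →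
        ∫⁻ x, maxComm a β b f x ^ q ∂(gauss n) ≤ C * (∫⁻ x, ‖f x‖ₑ ^ p ∂(gauss n)) ^ (q / p) := by
  -- `s > 1` gives a finite conjugate exponent for `b`, and `s < p` puts `p / s` in the range of the
  -- maximal theorem.
  set s := (1 + p) / 2 with hs
  have hs1 : 1 < s := by rw [hs]; linarith
  have hsp : s < p := by rw [hs]; linarith
  have hs0 : 0 < s := by linarith
  have hp0 : 0 < p := by linarith
  have hq0 : 0 < q := by linarith
  have hconj : s.conjExponent.HolderConjugate s :=
    (Real.HolderConjugate.conjExponent hs1).symm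
  set s' := s.conjExponent
  have hps : 1 < p / s := (one_lt_div hs0).2 hsp
  have hnn : 0 ≤ q / p - 1 := by rw [sub_nonneg, one_le_div hp0]; exact hpq.le
  -- Moments are taken on the dilates `5P`, balls of `𝓑_{5a}`, and the moment bound there needs
  -- oscillations at twice that scale.
  obtain ⟨C₀, hC₀, hosc⟩ := meanOsc_le_of_admissible (𝕜 := 𝕜) n one_pos
    (A := 2 * (5 * a)) (by positivity)
  obtain ⟨C₁, hC₁, hH⟩ := lintegral_oscMax_rpow_le (𝕜 := 𝕜) n (a := 5 * a) (by positivity) ha.le C₀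
    hconj.lt.le (q := q) (by linarith)
  obtain ⟨D₅, hD₅, h₅⟩ := gauss_ball_five_le n ha.le
  obtain ⟨C₂, hC₂, hL⟩ := levelSum_le hq0
  obtain ⟨D, hD, hM⟩ := maxFun_strong n ha.le hps
  refine ⟨2 ^ q * (C₁ * D₅) * (C₂ * D), by positivity, fun b hbm hb hb1 f hfm hfI => ?_⟩
  set u : E n → ℝ≥0∞ := fun x => ‖f x‖ₑ with hu
  have hum : Measurable u := hfm.enorm
  set I := ∫⁻ x, u x ^ p ∂(gauss n) with hI
  have hosc' : ∀ c r, Admissible (2 * (5 * a)) c r → meanOsc b c r ≤ C₀ := fun c r hcr => by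
    simpa using hosc b hbm hb 1 (fun c r h => (meanOsc_le_starNorm b h).trans hb1) c r hcr
  -- Hedberg's majorant: it dominates the fractional average of every ball of `𝓑_a` containing `x`.
  set h : E n → ℝ≥0∞ := fun x =>
    (maxFun a (fun y => u y ^ s) x ^ (p / s) * I ^ (q / p - 1)) ^ (1 / q) with hh
  have hhm : Measurable h :=
    (((measurable_maxFun _ _).pow_const _).mul_const _).pow_const _
  have hhq : ∀ x, h x ^ q = maxFun a (fun y => u y ^ s) x ^ (p / s) * I ^ (q / p - 1) := fun x => by
    rw [hh, ← ENNReal.rpow_mul, one_div_mul_cancel hq0.ne', ENNReal.rpow_one]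
  have hhint : ∫⁻ x, h x ^ q ∂(gauss n) ≤ D * I ^ (q / p) := by
    simp_rw [hhq]
    rw [lintegral_mul_const _ ((measurable_maxFun _ _).pow_const _)]
    calc (∫⁻ x, maxFun a (fun y => u y ^ s) x ^ (p / s) ∂(gauss n)) * I ^ (q / p - 1)
        ≤ (D * ∫⁻ x, (u x ^ s) ^ (p / s) ∂(gauss n)) * I ^ (q / p - 1) := by
          gcongr
          exact hM _ (hum.pow_const s)
      _ = D * (I ^ (1 : ℝ) * I ^ (q / p - 1)) := by
          simp_rw [← ENNReal.rpow_mul, mul_div_cancel₀ p hs0.ne']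
          rw [ENNReal.rpow_one, mul_assoc]
      _ = _ := by
          rw [← ENNReal.rpow_add_of_nonneg _ _ zero_le_one hnn, add_sub_cancel]
  have hfrac : ∀ c r, Admissible a c r → ∀ x ∈ ball c r, fracAv β s u c r ≤ h x := by
    intro c r hcr x hx
    rw [← ENNReal.rpow_le_rpow_iff hq0, hhq]
    refine (fracAv_rpow_le hs1.le hsp.le hpq.le hpqβ hum c hcr.1).trans ?_
    gcongr
    exact av_le_maxFun hcr hx
  choose F hFt hFc hFd hFcov using fun k : ℤ => exists_countable_vitali
    {p : E n × ℝ | Admissible a p.1 p.2 ∧ (2 : ℝ≥0∞) ^ k < fracAv β s u p.1 p.2} a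
    (fun p hp => ⟨hp.1.1, admissible_le ha.le hp.1⟩)
  set S : E n → ℝ≥0∞ := fun x => ∑' k : ℤ, ∑' p : F k, ((2 : ℝ≥0∞) ^ (k + 1)) ^ q *
    indicator (ball p.1.1 (5 * p.1.2))
      (fun y => oscMax a s' b p.1.1 (5 * p.1.2) y ^ q) x with hS
  have hpt : ∀ x, maxComm a β b f x ^ q ≤ S x := by
    intro x
    rw [← ENNReal.le_rpow_inv_iff hq0]
    refine iSup_le fun c => iSup_le fun r => iSup_le fun hcr => iSup_le fun hx => ?_
    have hterm := fun κ => commAv_le (β := β) hconj hs1.le hbm hfm x c hcr.1 κ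
    rcases eq_or_ne (fracAv β s u c r) 0 with h0 | h0
    · refine (hterm 0).trans ?_
      rw [h0, zero_mul]
      exact zero_le
    obtain ⟨k, hk1, hk2⟩ := ENNReal.exists_mem_Ioc_zpow h0
      (fracAv_ne_top hβ0.le hs1.le hsp.le hum hfI c hcr.1) (y := 2) (by norm_num) (by norm_num)
    obtain ⟨P, hP, hBP⟩ := hFcov k (c, r) ⟨hcr, hk1⟩
    rw [ENNReal.le_rpow_inv_iff hq0]
    -- Centring at the mean over `5P` removes the dependence on the ball: it lies in `5P`, so its
    -- average of the oscillation is one of those in the maximal function localised to `5P`.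
    calc _ ≤ ((2 : ℝ≥0∞) ^ (k + 1) * oscMax a s' b P.1 (5 * P.2) x) ^ q := by
          refine ENNReal.rpow_le_rpow ((hterm (mean b P.1 (5 * P.2))).trans ?_) hq0.le
          unfold oscMax
          have : 0 < s' := hconj.pos
          gcongr
          refine le_trans (av_mono_on fun y hy => ?_) (av_le_maxFun hcr hx)
          rw [indicator_of_mem (hBP hy)]
      _ = ((2 : ℝ≥0∞) ^ (k + 1)) ^ q * indicator (ball P.1 (5 * P.2))
            (fun y => oscMax a s' b P.1 (5 * P.2) y ^ q) x := by
          rw [ENNReal.mul_rpow_of_nonneg _ _ hq0.le, indicator_of_mem (hBP hx)]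
      _ ≤ ∑' p : F k, ((2 : ℝ≥0∞) ^ (k + 1)) ^ q * indicator (ball p.1.1 (5 * p.1.2))
            (fun y => oscMax a s' b p.1.1 (5 * p.1.2) y ^ q) x :=
          ENNReal.le_tsum (⟨P, hP⟩ : F k)
      _ ≤ S x := ENNReal.le_tsum k
  have hcnt : ∀ k, Countable (F k) := fun k => (hFc k).to_subtype
  have hmeas : ∀ (k : ℤ) (p : F k), Measurable fun x => ((2 : ℝ≥0∞) ^ (k + 1)) ^ q *
      indicator (ball p.1.1 (5 * p.1.2))
        (fun y => oscMax a s' b p.1.1 (5 * p.1.2) y ^ q) x := fun k p =>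
    (((measurable_oscMax a s' hbm _ _).pow_const q).indicator measurableSet_ball).const_mul _
  calc ∫⁻ x, maxComm a β b f x ^ q ∂(gauss n) ≤ ∫⁻ x, S x ∂(gauss n) := lintegral_mono hpt
    _ = ∑' k : ℤ, ∑' p : F k, ((2 : ℝ≥0∞) ^ (k + 1)) ^ q *
          ∫⁻ x in ball p.1.1 (5 * p.1.2), oscMax a s' b p.1.1 (5 * p.1.2) x ^ q ∂(gauss n) := by
        rw [hS, lintegral_tsum fun k => (Measurable.tsum (hmeas k)).aemeasurable]
        refine tsum_congr fun k => ?_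
        rw [lintegral_tsum fun p => (hmeas k p).aemeasurable]
        refine tsum_congr fun p => ?_
        rw [lintegral_const_mul _
          (((measurable_oscMax a s' hbm _ _).pow_const q).indicator measurableSet_ball),
          lintegral_indicator measurableSet_ball]
    _ ≤ ∑' k : ℤ, ∑' p : F k, ((2 : ℝ≥0∞) ^ (k + 1)) ^ q *
          (C₁ * (D₅ * gauss n (ball p.1.1 p.1.2))) := by
        gcongr ∑' k : ℤ, ∑' p : F k, _ * ?_ with k p
        have hp := (hFt k p.2).1
        refine (hH b hbm hb hosc' _ _ (hp.mul (by norm_num))).trans ?_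
        gcongr
        exact h₅ _ _ hp
    _ = ∑' k : ℤ, 2 ^ q * (C₁ * D₅) * (((2 : ℝ≥0∞) ^ k) ^ q *
          gauss n (⋃ p ∈ F k, ball p.1 p.2)) := by
        refine tsum_congr fun k => ?_
        rw [ENNReal.tsum_mul_left, ENNReal.tsum_mul_left, ENNReal.tsum_mul_left, two_zpow_succ,
          ENNReal.mul_rpow_of_nonneg _ _ hq0.le,
          measure_biUnion (hFc k) (hFd k) fun _ _ => measurableSet_ball]
        ring
    _ ≤ ∑' k : ℤ, 2 ^ q * (C₁ * D₅) * (((2 : ℝ≥0∞) ^ k) ^ q *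
          gauss n {x | (2 : ℝ≥0∞) ^ k < h x}) := by
        gcongr ∑' k : ℤ, _ * (_ * gauss n ?_) with k
        refine iUnion₂_subset fun p hp x hx => ?_
        exact (hFt k hp).2.trans_le (hfrac _ _ (hFt k hp).1 x hx)
    _ = 2 ^ q * (C₁ * D₅) * ∫⁻ x, levelSum q (h x) ∂(gauss n) := by
        rw [ENNReal.tsum_mul_left, lintegral_levelSum _ _ hhm]
    _ ≤ 2 ^ q * (C₁ * D₅) * ∫⁻ x, C₂ * h x ^ q ∂(gauss n) := by
        gcongr _ * ?_
        exact lintegral_mono fun x => hL _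
    _ ≤ 2 ^ q * (C₁ * D₅) * (C₂ * (D * I ^ (q / p))) := by
        rw [lintegral_const_mul _ (hhm.pow_const q)]
        gcongr
    _ = _ := by
        push_cast
        rw [ENNReal.coe_rpow_of_nonneg _ hq0.le]
        push_cast
        ring

theorem eLpNorm_ofReal_eq {ε : Type*} [ENorm ε] {p : ℝ} (hp : 0 < p) (f : E n → ε) :
    eLpNorm f (ENNReal.ofReal p) (gauss n) = (∫⁻ x, ‖f x‖ₑ ^ p ∂(gauss n)) ^ (1 / p) := by
  rw [eLpNorm_eq_lintegral_rpow_enorm_toReal (by simpa using hp) ENNReal.ofReal_ne_top,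
    ENNReal.toReal_ofReal hp.le]

/-- The maximal commutator of a function `b ∈ BMO(γ)` is bounded from `L^p(γ)` to `L^q(γ)`. -/
theorem eLpNorm_maxComm_le (n : ℕ) {a β p q : ℝ} (ha : 0 < a) (hβ0 : 0 < β)
    (hp : 1 < p) (hpq : p < q) (hpqβ : 1 / q = 1 / p - β) :
    ∃ C : ℝ≥0, 0 < C ∧ ∀ b : E n → 𝕜, MemBMO b → ∀ f : E n → 𝕜,
      MemLp f (ENNReal.ofReal p) (gauss n) →
        eLpNorm (maxComm a β b f) (ENNReal.ofReal q) (gauss n) ≤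
          C * starNorm b * eLpNorm f (ENNReal.ofReal p) (gauss n) := by
  have hp0 : 0 < p := by linarith
  have hq0 : 0 < q := by linarith
  obtain ⟨C, hC, hmain⟩ := lintegral_maxComm_rpow_le (𝕜 := 𝕜) n ha hβ0 hp hpq hpqβ
  set C' : ℝ≥0 := C ^ (1 / q) with hC'
  refine ⟨C', by positivity, ?_⟩
  have unit : ∀ b : E n → 𝕜, Integrable b (gauss n) → starNorm b ≤ 1 → ∀ f : E n → 𝕜,
      MemLp f (ENNReal.ofReal p) (gauss n) →
        eLpNorm (maxComm a β b f) (ENNReal.ofReal q) (gauss n) ≤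
          C' * eLpNorm f (ENNReal.ofReal p) (gauss n) := by
    intro b hb hb1 f hf
    have hbae := hb.1.ae_eq_mk
    have hfae := hf.1.ae_eq_mk
    set b' := hb.1.mk b
    set f' := hf.1.mk f
    have hf' : MemLp f' (ENNReal.ofReal p) (gauss n) := (memLp_congr_ae hfae).1 hf
    rw [maxComm_congr_right hfae, eLpNorm_congr_ae (maxComm_congr_left hbae),
      eLpNorm_congr_ae hfae]
    have hfin : ∫⁻ x, ‖f' x‖ₑ ^ p ∂(gauss n) ≠ ∞ := by
      have := hf'.2
      rw [eLpNorm_ofReal_eq hp0, ENNReal.rpow_lt_top_iff_of_pos (by positivity)] at this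
      exact this.ne
    have := hmain b' hb.1.stronglyMeasurable_mk.measurable (hb.congr hbae)
      (starNorm_congr hbae ▸ hb1) f' hf.1.stronglyMeasurable_mk.measurable hfin
    rw [eLpNorm_ofReal_eq hq0, eLpNorm_ofReal_eq hp0]
    simp only [enorm_eq_self]
    calc (∫⁻ x, maxComm a β b' f' x ^ q ∂(gauss n)) ^ (1 / q)
        ≤ (C * (∫⁻ x, ‖f' x‖ₑ ^ p ∂(gauss n)) ^ (q / p)) ^ (1 / q) := by gcongr
      _ = _ := by
          rw [ENNReal.mul_rpow_of_nonneg _ _ (by positivity), ← ENNReal.rpow_mul, hC',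
            ENNReal.coe_rpow_of_nonneg _ (by positivity)]
          congr 2
          field_simp
  intro b hb f hf
  lift starNorm b to ℝ≥0 using hb.2.ne with N hN
  -- Normalising by `t` instead of `N` covers `N = 0`; afterwards `t` is taken arbitrarily close to
  -- `N`.
  have scaled : ∀ t : ℝ≥0, 0 < t → N ≤ t →
      eLpNorm (maxComm a β b f) (ENNReal.ofReal q) (gauss n) ≤
        t * (C' * eLpNorm f (ENNReal.ofReal p) (gauss n)) := by
    intro t ht hNt
    set z : 𝕜 := ((t : ℝ) : 𝕜) with hz
    have hz0 : z ≠ 0 := by simpa [hz] using ht.ne'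
    have hzn : ‖z‖ₑ = t := by
      rw [hz, ← ofReal_norm, RCLike.norm_ofReal, abs_of_nonneg t.coe_nonneg]
      exact ENNReal.ofReal_coe_nnreal
    have hstar : starNorm (z⁻¹ • b) ≤ 1 := by
      rw [starNorm_smul, ← hN, enorm_inv hz0, hzn, mul_comm, ← div_eq_mul_inv]
      exact ENNReal.div_le_of_le_mul (by simpa using hNt)
    have := unit (z⁻¹ • b) (hb.1.smul _) hstar f hf
    have heq : maxComm a β b f = fun x => t * maxComm a β (z⁻¹ • b) f x := by
      ext x
      rw [← hzn, ← maxComm_smul_left, smul_inv_smul₀ hz0]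
    rw [eLpNorm_ofReal_eq hq0] at this ⊢
    simp only [enorm_eq_self] at this ⊢
    rw [heq]
    simp_rw [ENNReal.mul_rpow_of_nonneg _ _ hq0.le]
    rw [lintegral_const_mul' _ _ (ENNReal.rpow_ne_top_of_nonneg hq0.le (by simp)),
      ENNReal.mul_rpow_of_nonneg _ _ (by positivity), ← ENNReal.rpow_mul,
      mul_one_div_cancel hq0.ne', ENNReal.rpow_one]
    gcongr
  lift eLpNorm f (ENNReal.ofReal p) (gauss n) to ℝ≥0 using hf.2.ne with F
  refine ENNReal.le_of_forall_pos_le_add fun ε hε _ => ?_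
  set δ : ℝ≥0 := ε / (C' * F + 1) with hδ
  have hδ0 : 0 < δ := by positivity
  refine (scaled (N + δ) (by positivity) le_self_add).trans ?_
  have : δ * (C' * F) ≤ ε := by
    rw [hδ, div_mul_eq_mul_div, div_le_iff₀ (by positivity)]
    gcongr
    exact le_self_add
  calc ((N + δ : ℝ≥0) : ℝ≥0∞) * (C' * F) = C' * N * F + (δ * (C' * F) : ℝ≥0) := by
        push_cast; ring
    _ ≤ _ := by gcongr

/-! ### Necessity of the BMO condition -/

/-- If the maximal commutator is bounded, the mean oscillations over the balls of `𝓑_a` are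
bounded. -/
theorem meanOsc_le_of_commBound {a β p q : ℝ} (hp : 1 < p) (hpq : p < q)
    (hpqβ : 1 / q = 1 / p - β) {b : E n → 𝕜} (hb : Integrable b (gauss n)) {K : ℝ≥0∞}
    (hK : CommBound a β (ENNReal.ofReal p) (ENNReal.ofReal q) b K) {c : E n} {r : ℝ}
    (h : Admissible a c r) : meanOsc b c r ≤ K := by
  have hp0 : 0 < p := by linarith
  have hq0 : 0 < q := by linarith
  set G := gauss n (ball c r) with hG
  have hG0 : G ≠ 0 := (gauss_ball_pos c h.1).ne'
  have hGt : G ≠ ∞ := gauss_ball_ne_top c r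
  set f : E n → 𝕜 := indicator (ball c r) fun _ => 1 with hf
  have hfL : MemLcInfty f :=
    ⟨memLp_indicator_const _ measurableSet_ball _ (Or.inr hGt),
      HasCompactSupport.of_support_subset_isCompact (isCompact_closedBall c r)
        (support_indicator_subset.trans ball_subset_closedBall)⟩
  obtain ⟨hM, hMle⟩ := hK f hfL
  set M := maxComm a β b f with hMdef
  have hMae : AEMeasurable M (gauss n) := hM.1.aemeasurable
  -- The ball itself competes in the supremum defining `M x`, and the test function is `1` on it.
  have hpt : ∀ x ∈ ball c r, ‖b x - mean b c r‖ₑ ≤ G ^ (-β) * M x := by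
    intro x hx
    have h1 : ‖b x - mean b c r‖ₑ ≤ av c r fun y => ‖b x - b y‖ₑ := by
      rw [enorm_sub_rev]
      simp_rw [fun y => enorm_sub_rev (b x) (b y)]
      exact enorm_mean_sub_le hb c h.1 (b x)
    have h2 : (G ^ (1 - β))⁻¹ * ∫⁻ y in ball c r, ‖b x - b y‖ₑ ∂(gauss n) ≤ M x := by
      refine le_iSup_of_le c <| le_iSup_of_le r <| le_iSup_of_le h <| le_iSup_of_le hx ?_
      gcongr 1
      refine setLIntegral_mono' measurableSet_ball fun y hy => ?_
      simp [hf, indicator_of_mem hy]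
    refine h1.trans ?_
    calc av c r (fun y => ‖b x - b y‖ₑ)
        = G ^ (-β) * ((G ^ (1 - β))⁻¹ * ∫⁻ y in ball c r, ‖b x - b y‖ₑ ∂(gauss n)) := by
          rw [av, ← mul_assoc, ← ENNReal.rpow_neg, ← ENNReal.rpow_add _ _ hG0 hGt, ← hG,
            ← ENNReal.rpow_neg_one]
          congr 2; ring
      _ ≤ _ := by gcongr
  have hf_norm : eLpNorm f (ENNReal.ofReal p) (gauss n) = G ^ (1 / p) := by
    rw [hf, eLpNorm_indicator_const measurableSet_ball (by simpa using hp0) ENNReal.ofReal_ne_top,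
      ENNReal.toReal_ofReal hp0.le]
    simp [hG]
  rw [hf_norm, eLpNorm_ofReal_eq hq0] at hMle
  simp only [enorm_eq_self] at hMle
  calc meanOsc b c r ≤ av c r (fun x => G ^ (-β) * M x) := av_mono_on hpt
    _ = G ^ (-β) * av c r M := by
        unfold av
        rw [lintegral_const_mul' _ _ (by simp [ENNReal.rpow_eq_top_iff, hG0, hGt]), mul_left_comm]
    _ ≤ G ^ (-β) * av c r (fun x => M x ^ q) ^ (1 / q) := by
        gcongr
        exact av_le_rpow_av c h.1 (by linarith) hMae
    _ ≤ G ^ (-β) * (G⁻¹ * ∫⁻ x, M x ^ q ∂(gauss n)) ^ (1 / q) := by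
        unfold av
        gcongr
        exact Measure.restrict_le_self
    _ = G ^ (-β) * (G ^ (-(1 / q)) * (∫⁻ x, M x ^ q ∂(gauss n)) ^ (1 / q)) := by
        rw [ENNReal.mul_rpow_of_nonneg _ _ (by positivity), ENNReal.rpow_neg _ (1 / q),
          ENNReal.inv_rpow]
    _ ≤ G ^ (-β) * (G ^ (-(1 / q)) * (K * G ^ (1 / p))) := by gcongr
    _ = (G ^ (-β) * G ^ (-(1 / q)) * G ^ (1 / p)) * K := by ring
    _ = K := by
        rw [← ENNReal.rpow_add _ _ hG0 hGt, ← ENNReal.rpow_add _ _ hG0 hGt,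
          show -β + -(1 / q) + 1 / p = 0 by linarith, ENNReal.rpow_zero, one_mul]

/-! ### Extension to all of `L^p` -/

/-- A bounded sublinear operator is continuous. -/
theorem IsSublinear.normContinuous {p q : ℝ≥0∞} [Fact (1 ≤ p)] [Fact (1 ≤ q)]
    {S : Lp 𝕜 p (gauss n) → Lp ℝ q (gauss n)} (hS : IsSublinear S) {K : ℝ≥0}
    (hK : OpBound S K) : NormContinuous S := by
  -- Subadditivity in both directions, with homogeneity for the scalar `-1`, gives `|S G - S F| ≤ S
  -- (G - F)` almost everywhere.
  have habs : ∀ F G, ‖S G - S F‖ ≤ K * ‖G - F‖ := by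
    intro F G
    have h1 : S G ≤ S (G - F) + S F := by simpa using hS.1 (G - F) F
    have h2 : S F ≤ S (G - F) + S G := by
      have hneg : S (F - G) = S (G - F) := by
        have := hS.2 (-1) (G - F)
        simpa using this
      have := hS.1 (F - G) G
      rwa [sub_add_cancel, hneg] at this
    have h3 : eLpNorm (S G - S F : Lp ℝ q (gauss n)) q (gauss n) ≤
        eLpNorm (S (G - F)) q (gauss n) := by
      refine eLpNorm_mono_ae ?_
      filter_upwards [(Lp.coeFn_le _ _).2 h1, (Lp.coeFn_le _ _).2 h2, Lp.coeFn_sub (S G) (S F),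
        Lp.coeFn_add (S (G - F)) (S F), Lp.coeFn_add (S (G - F)) (S G)] with x e1 e2 e3 e4 e5
      rw [e3]
      rw [e4] at e1
      rw [e5] at e2
      simp only [Pi.add_apply, Pi.sub_apply, Real.norm_eq_abs] at *
      exact (abs_le.2 ⟨by linarith, by linarith⟩).trans (le_abs_self _)
    have h4 := h3.trans (hK (G - F))
    rw [Lp.norm_def, Lp.norm_def]
    have := ENNReal.toReal_mono (ENNReal.mul_ne_top (by simp) (Lp.eLpNorm_ne_top _)) h4
    simpa using this
  intro F ε hε
  refine ⟨ε / (K + 1), by positivity, fun G hG => ?_⟩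
  rw [lt_div_iff₀ (by positivity)] at hG
  calc ‖S G - S F‖ ≤ K * ‖G - F‖ := habs F G
    _ ≤ ‖G - F‖ * (K + 1) := by nlinarith [norm_nonneg (G - F)]
    _ < ε := hG

/-- Two continuous extensions of the maximal commutator coincide. -/
theorem ExtendsComm.unique {a β : ℝ} {p q : ℝ≥0∞} [Fact (1 ≤ p)] [Fact (1 ≤ q)] (hp : p ≠ ∞)
    {b : E n → 𝕜} {S T : Lp 𝕜 p (gauss n) → Lp ℝ q (gauss n)}
    (hS : ExtendsComm a β p q b S) (hT : ExtendsComm a β p q b T)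
    (hSc : NormContinuous S) (hTc : NormContinuous T) : S = T := by
  ext1 F
  refine eq_of_forall_dist_le fun ε hε => ?_
  obtain ⟨δ₁, hδ₁, h₁⟩ := hSc F (ε / 2) (by positivity)
  obtain ⟨δ₂, hδ₂, h₂⟩ := hTc F (ε / 2) (by positivity)
  set δ := min δ₁ δ₂ / 2 with hδ
  have hδ0 : 0 < δ := by positivity
  -- Continuous functions of compact support are dense and belong to `L_c^∞`, where both extensions
  -- are prescribed.
  obtain ⟨f, hfs, hfε, hfc, hfm⟩ := (Lp.memLp F).exists_hasCompactSupport_eLpNorm_sub_le hp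
    (ε := ENNReal.ofReal δ) (by simpa using hδ0)
  set G := hfm.toLp f with hG
  have hGf : G =ᵐ[gauss n] f := hfm.coeFn_toLp
  have hmem : MemLcInfty f := ⟨hfc.memLp_top_of_hasCompactSupport hfs _, hfs⟩
  have hSG : S G = T G := Lp.ext ((hS f hmem G hGf).trans (hT f hmem G hGf).symm)
  have hd : ‖G - F‖ ≤ δ := by
    rw [norm_sub_rev, Lp.norm_def]
    have : eLpNorm (F - G : Lp 𝕜 p (gauss n)) p (gauss n) ≤ ENNReal.ofReal δ := by
      refine le_trans (le_of_eq (eLpNorm_congr_ae ?_)) hfε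
      filter_upwards [Lp.coeFn_sub F G, hGf] with x e1 e2
      rw [e1, Pi.sub_apply, Pi.sub_apply, e2]
    exact ENNReal.toReal_le_of_le_ofReal hδ0.le this
  have hδm : δ < min δ₁ δ₂ := half_lt_self (lt_min hδ₁ hδ₂)
  have e1 := h₁ G (hd.trans_lt (hδm.trans_le (min_le_left _ _)))
  have e2 := h₂ G (hd.trans_lt (hδm.trans_le (min_le_right _ _)))
  rw [dist_eq_norm, ← sub_sub_sub_cancel_left _ _ (S G)]
  nth_rw 1 [hSG]
  exact (norm_sub_le _ _).trans (by linarith)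

/-- A maximal commutator that is bounded on all of `L^p(γ)` defines a sublinear operator. -/
theorem exists_isSublinear_extendsComm {a β : ℝ} (hβ : β ≤ 1) {p q : ℝ≥0∞} (hq0 : q ≠ 0)
    (hq : q ≠ ∞) {b : E n → 𝕜} (hb : AEStronglyMeasurable b (gauss n)) {K : ℝ≥0∞} (hK : K ≠ ∞)
    (h : ∀ f : E n → 𝕜, MemLp f p (gauss n) →
      eLpNorm (maxComm a β b f) q (gauss n) ≤ K * eLpNorm f p (gauss n)) :
    ∃ T : Lp 𝕜 p (gauss n) → Lp ℝ q (gauss n),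
      ExtendsComm a β p q b T ∧ IsSublinear T ∧ OpBound T K := by
  have hae : ∀ F : Lp 𝕜 p (gauss n), AEMeasurable (maxComm a β b F) (gauss n) := fun F =>
    aemeasurable_maxComm hβ hb (Lp.aestronglyMeasurable F)
  have hlt : ∀ F : Lp 𝕜 p (gauss n), eLpNorm (maxComm a β b F) q (gauss n) < ∞ := fun F =>
    (h F (Lp.memLp F)).trans_lt (ENNReal.mul_lt_top hK.lt_top (Lp.eLpNorm_lt_top F))
  -- `toReal` sends `∞` to `0`, so subadditivity passes to real values only where the summands are
  -- finite.
  have hfin : ∀ F : Lp 𝕜 p (gauss n), ∀ᵐ x ∂(gauss n), maxComm a β b F x ≠ ∞ := fun F => by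
    have h1 := lintegral_rpow_enorm_lt_top_of_eLpNorm_lt_top hq0 hq (hlt F)
    filter_upwards [ae_lt_top' ((hae F).enorm.pow_const _) h1.ne] with x hx hx'
    simp [hx', ENNReal.toReal_pos hq0 hq] at hx
  have hle : ∀ F : Lp 𝕜 p (gauss n), eLpNorm (fun x => (maxComm a β b F x).toReal) q (gauss n) ≤
      eLpNorm (maxComm a β b F) q (gauss n) := fun F => eLpNorm_mono_enorm fun x => by
    rw [Real.enorm_of_nonneg ENNReal.toReal_nonneg]
    exact ENNReal.ofReal_toReal_le
  have hmem : ∀ F : Lp 𝕜 p (gauss n),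
      MemLp (fun x => (maxComm a β b F x).toReal) q (gauss n) := fun F =>
    ⟨(hae F).ennreal_toReal.aestronglyMeasurable, (hle F).trans_lt (hlt F)⟩
  have hco := fun F => (hmem F).coeFn_toLp
  refine ⟨fun F => (hmem F).toLp _, ?_, ⟨?_, ?_⟩, ?_⟩
  · intro f _ F hF
    rw [← maxComm_congr_right hF]
    exact hco F
  · intro F G
    rw [← Lp.coeFn_le]
    filter_upwards [hco F, hco G, hco (F + G), Lp.coeFn_add ((hmem F).toLp _) ((hmem G).toLp _),
      hfin F, hfin G] with x e1 e2 e3 e4 e5 e6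
    rw [e3, e4, Pi.add_apply, e1, e2, maxComm_congr_right (Lp.coeFn_add F G),
      ← ENNReal.toReal_add e5 e6]
    exact ENNReal.toReal_mono (ENNReal.add_ne_top.2 ⟨e5, e6⟩)
      (maxComm_add_le a β hb (Lp.aestronglyMeasurable F) x)
  · intro z F
    refine Lp.ext ?_
    filter_upwards [hco F, hco (z • F), Lp.coeFn_smul ‖z‖ ((hmem F).toLp _)] with x e1 e2 e3
    rw [e2, e3, Pi.smul_apply, e1, maxComm_congr_right (Lp.coeFn_smul z F), maxComm_smul_right]
    simp
  · intro F
    rw [eLpNorm_congr_ae (hco F)]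
    exact (hle F).trans (h F (Lp.memLp F))

end GaussBMO

end

theorem theorem1p2 {𝕜 : Type*} [RCLike 𝕜] (n : ℕ) (hn : 1 ≤ n) (a β p q : ℝ)
    (ha : 0 < a) (hβ0 : 0 < β) (hβ1 : β < 1) (hp : 1 < p) (hpq : p < q)
    (hpqβ : 1 / q = 1 / p - β) :
    ∃ C : ℝ≥0, 0 < C ∧
      (∀ b : EuclideanSpace ℝ (Fin n) → 𝕜, GaussBMO.MemBMO b →
        GaussBMO.CommBound a β (ENNReal.ofReal p) (ENNReal.ofReal q) b
          (C * GaussBMO.starNorm b) ∧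
        ∃ T : Lp 𝕜 (ENNReal.ofReal p) (GaussBMO.gauss n) →
            Lp ℝ (ENNReal.ofReal q) (GaussBMO.gauss n),
          GaussBMO.ExtendsComm a β (ENNReal.ofReal p) (ENNReal.ofReal q) b T ∧
          GaussBMO.IsSublinear T ∧
          GaussBMO.NormContinuous T ∧
          GaussBMO.OpBound T (C * GaussBMO.starNorm b) ∧
          ∀ S : Lp 𝕜 (ENNReal.ofReal p) (GaussBMO.gauss n) →
              Lp ℝ (ENNReal.ofReal q) (GaussBMO.gauss n),
            GaussBMO.ExtendsComm a β (ENNReal.ofReal p) (ENNReal.ofReal q) b S →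
            (GaussBMO.NormContinuous S ∨
              (GaussBMO.IsSublinear S ∧ ∃ K : ℝ≥0, GaussBMO.OpBound S K)) →
            S = T) ∧
      (∀ b : EuclideanSpace ℝ (Fin n) → 𝕜, Integrable b (GaussBMO.gauss n) →
        (∃ K : ℝ≥0,
          GaussBMO.CommBound a β (ENNReal.ofReal p) (ENNReal.ofReal q) b K) →
        GaussBMO.MemBMO b ∧
        GaussBMO.bmoNorm b ≤ eLpNorm b 1 (GaussBMO.gauss n) +
          C * GaussBMO.commNorm a β (ENNReal.ofReal p) (ENNReal.ofReal q) b) := by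
  obtain ⟨C₁, hC₁, h₁⟩ := GaussBMO.eLpNorm_maxComm_le (𝕜 := 𝕜) n ha hβ0 hp hpq hpqβ
  obtain ⟨C₂, hC₂, h₂⟩ := GaussBMO.meanOsc_le_of_admissible (𝕜 := 𝕜) n ha one_pos
  have : Fact (1 ≤ ENNReal.ofReal p) := ⟨by simpa using hp.le⟩
  have : Fact (1 ≤ ENNReal.ofReal q) := ⟨by simpa using (hp.trans hpq).le⟩
  have hq0 : ENNReal.ofReal q ≠ 0 := by simp; linarith
  -- `C₁` serves the sufficiency, and `C₂`, from the change of scale `a` to `1`, the necessity.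
  refine ⟨C₁ + C₂, by positivity, fun b hb => ?_, fun b hb ⟨K₀, hK₀⟩ => ?_⟩
  · have hbound : ∀ f : EuclideanSpace ℝ (Fin n) → 𝕜,
        MemLp f (ENNReal.ofReal p) (GaussBMO.gauss n) →
        eLpNorm (GaussBMO.maxComm a β b f) (ENNReal.ofReal q) (GaussBMO.gauss n) ≤
          ((C₁ + C₂ : ℝ≥0) * GaussBMO.starNorm b) *
            eLpNorm f (ENNReal.ofReal p) (GaussBMO.gauss n) := fun f hf =>
      (h₁ b hb f hf).trans (by gcongr; exact le_self_add)
    have hKt : ((C₁ + C₂ : ℝ≥0) * GaussBMO.starNorm b) ≠ ∞ := ENNReal.mul_ne_top (by simp) hb.2.ne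
    refine ⟨fun f hf => ?_, ?_⟩
    · have hfp : MemLp f (ENNReal.ofReal p) (GaussBMO.gauss n) := hf.1.mono_exponent le_top
      exact ⟨⟨(GaussBMO.aemeasurable_maxComm hβ1.le hb.1.1 hfp.1).aestronglyMeasurable,
        (hbound f hfp).trans_lt (ENNReal.mul_lt_top hKt.lt_top hfp.2)⟩, hbound f hfp⟩
    · obtain ⟨T, hT, hTs, hTb⟩ := GaussBMO.exists_isSublinear_extendsComm hβ1.le hq0
        ENNReal.ofReal_ne_top hb.1.1 hKt hbound
      have hTc : GaussBMO.NormContinuous T :=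
        hTs.normContinuous (K := ((C₁ + C₂ : ℝ≥0) * GaussBMO.starNorm b).toNNReal)
          (by rwa [ENNReal.coe_toNNReal hKt])
      refine ⟨T, hT, hTs, hTc, hTb, fun S hS hS' => ?_⟩
      refine hS.unique ENNReal.ofReal_ne_top hT ?_ hTc
      rcases hS' with hSc | ⟨hSs, K, hK⟩
      · exact hSc
      · exact hSs.normContinuous hK
  · have hstar : ∀ K : ℝ≥0,
        GaussBMO.CommBound a β (ENNReal.ofReal p) (ENNReal.ofReal q) b K →
        GaussBMO.starNorm b ≤ C₂ * K := by
      intro K hK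
      have hae := hb.1.ae_eq_mk
      refine iSup_le fun c => iSup_le fun r => iSup_le fun hcr => ?_
      rw [GaussBMO.meanOsc_congr hae]
      refine h₂ _ hb.1.stronglyMeasurable_mk.measurable (hb.congr hae) K (fun c r h => ?_) c r hcr
      rw [← GaussBMO.meanOsc_congr hae]
      exact GaussBMO.meanOsc_le_of_commBound hp hpq hpqβ hb hK h
    refine ⟨⟨hb, (hstar K₀ hK₀).trans_lt (by finiteness)⟩, ?_⟩
    rw [GaussBMO.bmoNorm, add_comm]
    gcongr
    -- Needed to move the constant inside the infimum: for an inadmissible `K` the inner infimum is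
    -- `∞`, and `0 * ∞ = 0`.
    have hC0 : ((C₁ + C₂ : ℝ≥0) : ℝ≥0∞) ≠ 0 := ENNReal.coe_ne_zero.2 (by positivity)
    rw [GaussBMO.commNorm, ENNReal.mul_iInf_of_ne hC0 ENNReal.coe_ne_top]
    refine le_iInf fun K => ?_
    rw [ENNReal.mul_iInf_of_ne hC0 ENNReal.coe_ne_top]
    exact le_iInf fun hK => (hstar K hK).trans (by gcongr; exact le_add_self)
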